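/- Model. Time is divided into synchronous slots on a single shared channel. Nodes are injected over time; all nodes run the same randomized algorithm from the slot they are injected until they succeed. They have no global clock and do not know the parameters $n,d$ below. In each slot every active node broadcasts or stays idle. A slot contains a success if it is not jammed and exactly one node broadcasts in it; that node then leaves the system at the end of the slot. There is no collision detection: at the end of each slot the active nodes learn only whether or not the slot contained a success. An adaptive adversary decides at the beginning of every slot, knowing the past behaviour of all nodes (but not their behaviour in the current slot), how many nodes to inject and whether to jam the slot; over the whole execution she injects at most $n$ nodes and jams at most $d$ slots. A slot is active if at least one node is active in it (injected and not yet successful). Theorem 1.1 (Dynamic Case Upper Bound). There is a randomized algorithm such that for every $\beta\ge 1$ there is a constant $C$, depending only on $\beta$, such that for all integers $n,d\ge 1$ and every adaptive adversary that injects at most $n$ nodes and jams at most $d$ slots: 1. with probability at least $1-(n+d)^{-\beta}$, the total number of active slots is at most $C\,(n\log n+d)$; in particular, in this event every injected node succeeds within that many active slots; 2. with probability at least $1-(n+d)^{-\beta}$, every node makes at most $C\,(\log^2(n+1)+\log^2(d+1))$ broadcast attempts. -/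

import Mathlib

open scoped ENNReal

noncomputable section

namespace ContentionResolution

/-- What an active node learns in one slot: whether it broadcast itself, and the binary channel
feedback (`heard = true` iff the slot contains a success). Silence, collision and jamming all give
`heard = false`, since there is no collision detection. -/
structure Observation where
  sent : Bool
  heard : Bool

/-- A randomized algorithm, run by each node from its activation on. In each slot the node
broadcasts with a probability determined by what it has observed since its activation (most recent
slot first, the current slot excluded), using fresh independent randomness. It has neither a global
clock nor an identifier, and it knows neither the number of nodes nor the jamming budget. -/
abbrev Algorithm := List Observation → unitInterval

/-- What happened in one slot: how many nodes were injected at its beginning, whether it was jammed,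
and which nodes broadcast. Nodes are numbered `0, 1, 2, …` in the order of arrival. -/
structure SlotRecord where
  arrivals : ℕ
  jammed : Bool
  senders : Finset ℕ

/-- The past of an execution, the most recent slot first. -/
abbrev History := List SlotRecord

/-- An adaptive (possibly randomized) adversary: at the beginning of each slot it sees the past
behaviour of all nodes and decides how many nodes to inject and whether to jam the slot. It does not
see the random choices of the nodes in the current slot. -/
abbrev Adversary := History → PMF (ℕ × Bool)

/-- A slot contains a success iff it is not jammed and exactly one node broadcasts. -/
def SlotRecord.success (r : SlotRecord) : Bool :=
  !r.jammed && decide (r.senders.card = 1)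

/-- Number of nodes injected so far. -/
def injected : History → ℕ
  | [] => 0
  | r :: h => injected h + r.arrivals

/-- Number of slots jammed so far. -/
def jams : History → ℕ
  | [] => 0
  | r :: h => jams h + if r.jammed then 1 else 0

/-- The nodes that have been injected and have not succeeded yet. A node leaves at the end of the
slot in which it succeeds. -/
def remaining : History → Finset ℕ
  | [] => ∅
  | r :: h =>
    let act := remaining h ∪ Finset.Ico (injected h) (injected h + r.arrivals)
    if r.success then act \ r.senders else act

/-- The nodes active in the slot that follows the history `h`, if `k` nodes are injected at the
beginning of that slot. -/
def activeNodes (h : History) (k : ℕ) : Finset ℕ :=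
  remaining h ∪ Finset.Ico (injected h) (injected h + k)

/-- Number of active slots so far, that is, slots in which at least one node is active. -/
def activeSlots : History → ℕ
  | [] => 0
  | r :: h => activeSlots h + if (activeNodes h r.arrivals).Nonempty then 1 else 0

/-- Number of broadcast attempts of node `i` so far. -/
def attempts (i : ℕ) : History → ℕ
  | [] => 0
  | r :: h => attempts i h + if i ∈ r.senders then 1 else 0

/-- What node `i` has observed since its activation, the most recent slot first. -/
def localView (i : ℕ) : History → List Observation
  | [] => []
  | r :: h =>
    if i < injected h + r.arrivals then ⟨decide (i ∈ r.senders), r.success⟩ :: localView i h else []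

/-- The random set of broadcasting nodes, if each node `i` in `s` broadcasts independently with
probability `p i`. -/
def senderSet (s : Finset ℕ) (p : ℕ → unitInterval) : PMF (Finset ℕ) :=
  PMF.ofFinset
    (fun t => if t ⊆ s then
      (∏ i ∈ t, ENNReal.ofReal (p i)) * ∏ i ∈ s \ t, ENNReal.ofReal (1 - p i) else 0)
    s.powerset
    (by
      have h1 : ∀ i ∈ s, ENNReal.ofReal (p i : ℝ) + ENNReal.ofReal (1 - (p i : ℝ)) = 1 := by
        intro i _
        rw [← ENNReal.ofReal_add (p i).2.1 (sub_nonneg.2 (p i).2.2)]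
        simp
      rw [Finset.sum_congr rfl fun t ht => if_pos (Finset.mem_powerset.1 ht), ← Finset.prod_add]
      exact Finset.prod_eq_one h1)
    (by
      intro t ht
      exact if_neg fun h => ht (Finset.mem_powerset.2 h))

/-- The law of the next slot after the history `h`: first the adversary acts, then, independently of
each other, the active nodes broadcast with the probabilities that the algorithm prescribes. -/
def nextSlot (A : Algorithm) (E : Adversary) (h : History) : PMF SlotRecord :=
  (E h).bind fun a =>
    (senderSet (activeNodes h a.1) fun i => A (localView i h)).map fun t => ⟨a.1, a.2, t⟩

/-- The law of the first `T` slots of the execution in which all nodes run `A` against `E`. -/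
def execution (A : Algorithm) (E : Adversary) : ℕ → PMF History
  | 0 => PMF.pure []
  | T + 1 => (execution A E T).bind fun h => (nextSlot A E h).map fun r => r :: h

/-- Against `A`, the adversary never injects more than `n` nodes and never jams more than `d`
slots. -/
def RespectsBudgets (A : Algorithm) (E : Adversary) (n d : ℕ) : Prop :=
  ∀ T, ∀ h ∈ (execution A E T).support, injected h ≤ n ∧ jams h ≤ d

/-- The bound on a quantity that can only grow during the execution, expressed by `good`, holds for
the whole execution with probability at least `p`. As `good` can only be lost over time, the
probability that it holds forever is the infimum (and the limit) over `T` of the probability that it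
holds after the first `T` slots. -/
def HoldsWithProb (A : Algorithm) (E : Adversary) (good : Set History) (p : ℝ) : Prop :=
  ∀ T, ENNReal.ofReal p ≤ (execution A E T).toOuterMeasure good

/-- `(f, g)`-time-cost: for every exponent `β ≥ 1` there is a constant `C` such that for all
`n, d ≥ 1` and every adaptive adversary with these budgets, the total number of active slots is at
most `C (f n + g d)` with probability at least `1 - 1 / (n + d) ^ β`. A slot is active as long as
some injected node has not succeeded, so in this event every injected node succeeds within that many
active slots. -/
def AchievesTimeCost (A : Algorithm) (f g : ℕ → ℝ) : Prop :=
  ∀ β : ℝ, 1 ≤ β → ∃ C : ℝ, ∀ n d : ℕ, 1 ≤ n → 1 ≤ d →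
    ∀ E : Adversary, RespectsBudgets A E n d →
      HoldsWithProb A E {h | (activeSlots h : ℝ) ≤ C * (f n + g d)}
        (1 - 1 / ((n : ℝ) + (d : ℝ)) ^ β)

/-- `(f, g)`-energy-cost: the same for the maximum number of broadcast attempts of a node. -/
def AchievesEnergyCost (A : Algorithm) (f g : ℕ → ℝ) : Prop :=
  ∀ β : ℝ, 1 ≤ β → ∃ C : ℝ, ∀ n d : ℕ, 1 ≤ n → 1 ≤ d →
    ∀ E : Adversary, RespectsBudgets A E n d →
      HoldsWithProb A E {h | ∀ i, (attempts i h : ℝ) ≤ C * (f n + g d)}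
        (1 - 1 / ((n : ℝ) + (d : ℝ)) ^ β)

end ContentionResolution

end

noncomputable section

namespace ContentionResolution

/-! ### Expectations, supermartingales and the maximal inequality -/

/-! The algorithm is `backoff`. Nodes that have heard a success agree on when the last one was,
hence share a clock modulo 2. Two slots alternate: at odd distance from the last success all nodes
use the high rate `log a / a` in their age `a` (shifted by 3); at even distance those that have
heard a success use the low rate `1 / a`. A node that has heard none yet ("fresh") always uses the
high rate.

High-rate slots make nodes leave. In an unjammed slot of contention at most 2, a node with rate `p`
succeeds with probability at least `e⁻⁴ p`. The high rate summed over ages from `l / K` to `l` is of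
order `log K * log l`, so if most of a node's odd slots are of this kind, it survives to age `l`
with probability polynomially small in `l`, with an exponent as large as desired through `K`
(`nodeDeficit_ge_log`).

Low-rate slots keep the number of crowded odd slots small (`card_oddLoaded_le`). Let `L` be the
logarithm of the number of active slots. If contention exceeds 2 in an odd slot without success,
then in the next, even, slot either the fresh mass is at least `1/2` or the low mass is at least
`1/(2L)`. Low mass at least 1 is rare, since each node contributes only a harmonic sum. Low mass in
between, with little fresh mass, gives success probability of order `1/L`, and there are at most `n`
successes. Large fresh mass is bounded window by window, a window being the time between two
successes: a node is fresh in one window only, and the bound is linear in the number of fresh nodes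
(`window_count`).

Randomness enters only through exponential supermartingales and Ville's inequality, applied to:
success rates against successes, globally and per window; the product over nodes of `1 + z * exp
(nodeDeficit)`; and attempts against expected attempts. The rest is deterministic, about a fixed
trace. Cut the run at `N` active slots, with `N` just above `C (n log n + d)`. These slots are
covered by the lifetimes of short-lived nodes, of nodes with many bad slots (a Vitali covering
argument), and of the remaining nodes, whose lengths the product potential bounds. With failure
exponent `B` of order `log N` this gives `N = O(n log N + d + √N log N)`, which is false for large
`C`. Energy follows: a node's expected attempts are at most the sum of the high rates up to age `N`,
which is `O(log² N)`. -/

/-- Expectation of an extended nonnegative function. -/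
def expect {α : Type*} (p : PMF α) (f : α → ℝ≥0∞) : ℝ≥0∞ := ∑' a, p a * f a

theorem expect_pure {α : Type*} (a : α) (f : α → ℝ≥0∞) : expect (PMF.pure a) f = f a := by
  unfold expect
  rw [tsum_eq_single a]
  · simp
  · intro b hb
    simp [PMF.pure_apply, hb]

theorem expect_bind {α β : Type*} (p : PMF α) (q : α → PMF β) (f : β → ℝ≥0∞) :
    expect (p.bind q) f = expect p fun a => expect (q a) f := by
  unfold expect
  simp only [PMF.bind_apply, ← ENNReal.tsum_mul_right, ← ENNReal.tsum_mul_left]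
  rw [ENNReal.tsum_comm]
  simp only [mul_assoc]

theorem expect_map {α β : Type*} (p : PMF α) (g : α → β) (f : β → ℝ≥0∞) :
    expect (p.map g) f = expect p fun a => f (g a) := by
  rw [PMF.map, expect_bind]
  simp only [Function.comp, expect_pure]

theorem expect_mono {α : Type*} (p : PMF α) {f g : α → ℝ≥0∞} (h : ∀ a, f a ≤ g a) :
    expect p f ≤ expect p g :=
  ENNReal.tsum_le_tsum fun a => mul_le_mul_right (h a) _

theorem expect_const {α : Type*} (p : PMF α) (c : ℝ≥0∞) : expect p (fun _ => c) = c := by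
  unfold expect
  rw [ENNReal.tsum_mul_right, p.tsum_coe, one_mul]

theorem toOuterMeasure_eq_expect {α : Type*} (p : PMF α) (s : Set α) :
    p.toOuterMeasure s = expect p (s.indicator 1) := by
  rw [PMF.toOuterMeasure_apply]
  refine tsum_congr fun a => ?_
  by_cases h : a ∈ s <;> simp [h]

theorem mul_toOuterMeasure_le_expect {α : Type*} (p : PMF α) (s : Set α) (c : ℝ≥0∞)
    (f : α → ℝ≥0∞) (hf : ∀ a ∈ s, c ≤ f a) : c * p.toOuterMeasure s ≤ expect p f := by
  rw [toOuterMeasure_eq_expect]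
  unfold expect
  rw [← ENNReal.tsum_mul_left]
  refine ENNReal.tsum_le_tsum fun a => ?_
  by_cases h : a ∈ s
  · simpa [h, mul_comm] using mul_le_mul_right (hf a h) (p a)
  · simp [h]

theorem toOuterMeasure_add_compl {α : Type*} (p : PMF α) (s : Set α) :
    p.toOuterMeasure s + p.toOuterMeasure sᶜ = 1 := by
  rw [PMF.toOuterMeasure_apply, PMF.toOuterMeasure_apply, ← ENNReal.tsum_add, ← p.tsum_coe]
  refine tsum_congr fun a => ?_
  by_cases h : a ∈ s <;> simp [h]

/-! ### Random sender sets and Ville's inequality. -/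

/-- The probability that `t` is the set of broadcasting nodes. -/
def weight (s : Finset ℕ) (p : ℕ → ℝ) (t : Finset ℕ) : ℝ :=
  (∏ i ∈ t, p i) * ∏ i ∈ s \ t, (1 - p i)

theorem weight_nonneg {s : Finset ℕ} {p : ℕ → ℝ} (h0 : ∀ i, 0 ≤ p i) (h1 : ∀ i, p i ≤ 1)
    (t : Finset ℕ) : 0 ≤ weight s p t :=
  mul_nonneg (Finset.prod_nonneg fun i _ => h0 i)
    (Finset.prod_nonneg fun i _ => sub_nonneg.2 (h1 i))

theorem sum_weight (s : Finset ℕ) (p : ℕ → ℝ) : ∑ t ∈ s.powerset, weight s p t = 1 := by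
  unfold weight
  rw [← Finset.prod_add]
  simp

theorem expect_senderSet (s : Finset ℕ) (p : ℕ → unitInterval) (f : Finset ℕ → ℝ)
    (hf : ∀ t, 0 ≤ f t) :
    expect (senderSet s p) (fun t => ENNReal.ofReal (f t)) =
      ENNReal.ofReal (∑ t ∈ s.powerset, weight s (fun i => (p i : ℝ)) t * f t) := by
  have h0 : ∀ i, 0 ≤ (p i : ℝ) := fun i => (p i).2.1
  have h1 : ∀ i, (p i : ℝ) ≤ 1 := fun i => (p i).2.2
  unfold expect
  rw [tsum_eq_sum (s := s.powerset)]
  · rw [ENNReal.ofReal_sum_of_nonneg fun t _ => mul_nonneg (weight_nonneg h0 h1 t) (hf t)]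
    refine Finset.sum_congr rfl fun t ht => ?_
    rw [ENNReal.ofReal_mul (weight_nonneg h0 h1 t)]
    congr 1
    unfold weight
    rw [ENNReal.ofReal_mul (Finset.prod_nonneg fun i _ => h0 i),
      ENNReal.ofReal_prod_of_nonneg fun i _ => h0 i,
      ENNReal.ofReal_prod_of_nonneg fun i _ => sub_nonneg.2 (h1 i)]
    simp [senderSet, PMF.ofFinset_apply, Finset.mem_powerset.1 ht]
  · intro t ht
    simp [senderSet, PMF.ofFinset_apply, Finset.mem_powerset] at ht ⊢
    simp [ht]

/-- Nonnegative functions of the history whose conditional expectation never increases, whatever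
the adversary does. -/
def IsSupermartingale (A : Algorithm) (W : History → ℝ) : Prop :=
  (∀ h, 0 ≤ W h) ∧ ∀ h k J,
    ∑ t ∈ (activeNodes h k).powerset,
      weight (activeNodes h k) (fun i => (A (localView i h) : ℝ)) t * W (⟨k, J, t⟩ :: h) ≤ W h

/-- Randomizing does not help the adversary: a bound valid for each of her choices `(k, J)` survives
averaging over them. -/
theorem expect_nextSlot_le {A : Algorithm} {h : History} {f : SlotRecord → ℝ} {c : ℝ}
    (hf : ∀ r, 0 ≤ f r)
    (hc : ∀ k J, ∑ t ∈ (activeNodes h k).powerset,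
      weight (activeNodes h k) (fun i => (A (localView i h) : ℝ)) t * f ⟨k, J, t⟩ ≤ c)
    (E : Adversary) :
    expect (nextSlot A E h) (fun r => ENNReal.ofReal (f r)) ≤ ENNReal.ofReal c := by
  unfold nextSlot
  rw [expect_bind]
  refine (expect_mono _ (g := fun _ => ENNReal.ofReal c) fun a => ?_).trans_eq (expect_const _ _)
  rw [expect_map, expect_senderSet _ _ (fun t => f ⟨a.1, a.2, t⟩) fun t => hf _]
  exact ENNReal.ofReal_le_ofReal (hc a.1 a.2)

theorem IsSupermartingale.expect_le {A : Algorithm} {W : History → ℝ}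
    (hW : IsSupermartingale A W) (E : Adversary) (T : ℕ) :
    expect (execution A E T) (fun h => ENNReal.ofReal (W h)) ≤ ENNReal.ofReal (W []) := by
  induction T with
  | zero => simp [execution, expect_pure]
  | succ T ih =>
    refine le_trans ?_ ih
    simp only [execution]
    rw [expect_bind]
    refine expect_mono _ fun h => ?_
    rw [expect_map]
    exact expect_nextSlot_le (fun r => hW.1 _) (fun k J => hW.2 h k J) E

/-- The supermartingale stopped when it first reaches the level `M`. -/
def stopped (W : History → ℝ) (M : ℝ) (h : History) : ℝ :=
  open Classical in if ∃ s, s <:+ h ∧ M ≤ W s then M else W h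

theorem stopped_le_of_not {W : History → ℝ} {M : ℝ} {h : History}
    (hn : ¬ ∃ s, s <:+ h ∧ M ≤ W s) (r : SlotRecord) : stopped W M (r :: h) ≤ W (r :: h) := by
  unfold stopped
  split_ifs with h1
  · obtain ⟨s, hs, hM⟩ := h1
    rcases List.suffix_cons_iff.1 hs with rfl | hs
    · exact hM
    · exact absurd ⟨s, hs, hM⟩ hn
  · exact le_rfl

theorem algorithm_weight_nonneg (A : Algorithm) (h : History) (s t : Finset ℕ) :
    0 ≤ weight s (fun i => (A (localView i h) : ℝ)) t :=
  weight_nonneg (fun i => (A (localView i h)).2.1) (fun i => (A (localView i h)).2.2) t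

/-- Histories list the newest slot first, so a suffix is an earlier moment. Freezing at `M` rather
than at the overshooting value only lowers the next value, and after freezing nothing moves. -/
theorem IsSupermartingale.stopped {A : Algorithm} {W : History → ℝ}
    (hW : IsSupermartingale A W) {M : ℝ} (hM : 0 ≤ M) :
    IsSupermartingale A (stopped W M) := by
  refine ⟨fun h => ?_, fun h k J => ?_⟩
  · unfold ContentionResolution.stopped
    split_ifs
    exacts [hM, hW.1 h]
  · by_cases hn : ∃ s, s <:+ h ∧ M ≤ W s
    · have h1 : ∀ r : SlotRecord, ContentionResolution.stopped W M (r :: h) = M := by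
        intro r
        obtain ⟨s, hs, hM⟩ := hn
        exact if_pos ⟨s, hs.trans (List.suffix_cons r h), hM⟩
      simp only [h1]
      rw [← Finset.sum_mul, sum_weight, one_mul]
      exact (if_pos hn).ge
    · refine le_trans (Finset.sum_le_sum fun t _ => mul_le_mul_of_nonneg_left
        (stopped_le_of_not hn _) (algorithm_weight_nonneg A h _ t)) ?_
      exact (hW.2 h k J).trans (if_neg hn).ge

/-- Ville's maximal inequality. -/
theorem IsSupermartingale.maximal {A : Algorithm} {W : History → ℝ}
    (hW : IsSupermartingale A W) {M : ℝ} (hM : 0 < M) (E : Adversary) (T : ℕ) :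
    (execution A E T).toOuterMeasure {h | ∃ s, s <:+ h ∧ M ≤ W s} ≤
      ENNReal.ofReal (W [] / M) := by
  have hst := hW.stopped hM.le
  have h1 := mul_toOuterMeasure_le_expect (execution A E T) {h | ∃ s, s <:+ h ∧ M ≤ W s}
    (ENNReal.ofReal M) (fun h => ENNReal.ofReal (ContentionResolution.stopped W M h))
    (fun h hh => ENNReal.ofReal_le_ofReal (if_pos hh).ge)
  have h2 : ContentionResolution.stopped W M [] ≤ W [] := by
    unfold ContentionResolution.stopped
    split_ifs with h3
    · obtain ⟨s, hs, hM⟩ := h3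
      rwa [List.suffix_nil.1 hs] at hM
    · exact le_rfl
  have h3 := (h1.trans (hst.expect_le E T)).trans (ENNReal.ofReal_le_ofReal h2)
  rw [ENNReal.ofReal_div_of_pos hM, ENNReal.le_div_iff_mul_le
    (Or.inl (ENNReal.ofReal_pos.2 hM).ne') (Or.inl ENNReal.ofReal_ne_top), mul_comm]
  exact h3

/-- Separates probability from combinatorics: outside `bad`, only reachable histories have to be
examined, where the budgets and `Valid` are available. -/
theorem holdsWithProb_of_bad {A : Algorithm} {E : Adversary} {good : Set History}
    {bad : Set History} {p : ℝ} (hp : 0 ≤ p)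
    (hbad : ∀ T, (execution A E T).toOuterMeasure bad ≤ ENNReal.ofReal p)
    (hgood : ∀ T, ∀ h ∈ (execution A E T).support, h ∉ bad → h ∈ good) :
    HoldsWithProb A E good (1 - p) := by
  intro T
  have h1 : (execution A E T).toOuterMeasure goodᶜ ≤ ENNReal.ofReal p := by
    refine le_trans (PMF.toOuterMeasure_mono _ ?_) (hbad T)
    rintro h ⟨hg, hs⟩
    by_contra hb
    exact hg (hgood T h hs hb)
  rw [ENNReal.ofReal_sub _ hp, ENNReal.ofReal_one, ← toOuterMeasure_add_compl _ good]
  exact tsub_le_iff_right.2 (by gcongr)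

/-! ### Success probabilities in one slot -/

theorem exp_neg_two_mul_le {x : ℝ} (h0 : 0 ≤ x) (h1 : x ≤ 1 / 2) :
    Real.exp (-(2 * x)) ≤ 1 - x := by
  rw [Real.exp_neg, inv_le_comm₀ (Real.exp_pos _) (by linarith)]
  refine le_trans ?_ (Real.add_one_le_exp (2 * x))
  rw [inv_le_iff_one_le_mul₀ (by linarith)]
  nlinarith

/-- Origin of the factor one half in the deficits: a success of probability `y` divides an
exponential potential by `e`, a relative loss `1 - e⁻¹ ≥ 1/2`, which pays for growth by `exp (x /
2)` when `x ≤ y`. -/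
theorem exp_half_mul_le {x y : ℝ} (h0 : 0 ≤ x) (hxy : x ≤ y) :
    Real.exp (x / 2) * (1 - y * (1 - Real.exp (-1))) ≤ 1 := by
  have he : Real.exp (-1) ≤ 1 / 2 := by
    have := exp_neg_two_mul_le (x := 1 / 2) (by norm_num) le_rfl
    norm_num at this ⊢
    exact this
  have h1 : 1 - y * (1 - Real.exp (-1)) ≤ Real.exp (-(x / 2)) := by
    have := Real.add_one_le_exp (-(x / 2))
    nlinarith
  calc _ ≤ Real.exp (x / 2) * Real.exp (-(x / 2)) := by gcongr
    _ = 1 := by rw [← Real.exp_add]; simp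

theorem one_sub_sum_le_prod (s : Finset ℕ) (x : ℕ → ℝ) (h0 : ∀ i ∈ s, 0 ≤ x i)
    (h1 : ∀ i ∈ s, x i ≤ 1) : 1 - ∑ i ∈ s, x i ≤ ∏ i ∈ s, (1 - x i) := by
  induction s using Finset.induction_on with
  | empty => simp
  | insert a s ha ih =>
    rw [Finset.sum_insert ha, Finset.prod_insert ha]
    have ih' := ih (fun i hi => h0 i (Finset.mem_insert_of_mem hi))
      (fun i hi => h1 i (Finset.mem_insert_of_mem hi))
    have a0 := h0 a (Finset.mem_insert_self a s)
    have a1 := h1 a (Finset.mem_insert_self a s)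
    have hs : 0 ≤ ∑ i ∈ s, x i :=
      Finset.sum_nonneg fun i hi => h0 i (Finset.mem_insert_of_mem hi)
    have := mul_le_mul_of_nonneg_left ih' (sub_nonneg.2 a1)
    nlinarith [mul_nonneg a0 hs]

/-- Node `i` sends and all others are silent; rates at most `1/2` give `1 - p ≥ exp (-2p)` for each
of the others. -/
theorem mul_exp_le_weight_singleton {s : Finset ℕ} {p : ℕ → ℝ} (h0 : ∀ i, 0 ≤ p i)
    (h1 : ∀ i, p i ≤ 1 / 2) (i : ℕ) :
    p i * Real.exp (-(2 * ∑ j ∈ s, p j)) ≤ weight s p {i} := by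
  unfold weight
  rw [Finset.prod_singleton]
  refine mul_le_mul_of_nonneg_left ?_ (h0 i)
  calc Real.exp (-(2 * ∑ j ∈ s, p j)) ≤ Real.exp (∑ j ∈ s \ {i}, -(2 * p j)) := by
        rw [Real.exp_le_exp, Finset.sum_neg_distrib, ← Finset.mul_sum]
        have := Finset.sum_le_sum_of_subset_of_nonneg (Finset.sdiff_subset (s := s) (t := {i}))
          fun j _ _ => h0 j
        linarith
    _ = ∏ j ∈ s \ {i}, Real.exp (-(2 * p j)) := Real.exp_sum _ _
    _ ≤ ∏ j ∈ s \ {i}, (1 - p j) :=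
        Finset.prod_le_prod (fun _ _ => (Real.exp_pos _).le)
          fun j _ => exp_neg_two_mul_le (h0 j) (h1 j)

theorem weight_singleton_le_one {s : Finset ℕ} {p : ℕ → ℝ} (h0 : ∀ i, 0 ≤ p i)
    (h1 : ∀ i, p i ≤ 1) (i : ℕ) : weight s p {i} ≤ 1 := by
  unfold weight
  rw [Finset.prod_singleton]
  exact mul_le_one₀ (h1 i) (Finset.prod_nonneg fun j _ => sub_nonneg.2 (h1 j))
    (Finset.prod_le_one (fun j _ => sub_nonneg.2 (h1 j)) fun j _ => by linarith [h0 j])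

/-- Only singletons can be successes, so all other outcomes are lumped into the common bound `b` and
just the singleton probabilities remain. -/
theorem sum_weight_mul_le {s : Finset ℕ} {p : ℕ → ℝ} (h0 : ∀ i, 0 ≤ p i) (h1 : ∀ i, p i ≤ 1)
    {f : Finset ℕ → ℝ} {a : ℕ → ℝ} {b : ℝ} (hb : ∀ t ⊆ s, t.card ≠ 1 → f t ≤ b)
    (ha : ∀ i ∈ s, f {i} ≤ a i) :
    ∑ t ∈ s.powerset, weight s p t * f t ≤ b - ∑ i ∈ s, weight s p {i} * (b - a i) := by
  have key : ∀ t ∈ s.powerset,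
      f t ≤ b - ∑ i ∈ s, if t = {i} then b - a i else 0 := by
    intro t ht
    rw [Finset.mem_powerset] at ht
    by_cases hc : t.card = 1
    · obtain ⟨i, rfl⟩ := Finset.card_eq_one.1 hc
      have hi : i ∈ s := ht (Finset.mem_singleton_self i)
      simp only [Finset.singleton_inj]
      rw [Finset.sum_ite_eq, if_pos hi]
      linarith [ha i hi]
    · rw [Finset.sum_eq_zero, sub_zero]
      · exact hb t ht hc
      · intro i _
        rw [if_neg]
        rintro rfl
        exact hc (Finset.card_singleton i)
  calc ∑ t ∈ s.powerset, weight s p t * f t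
      ≤ ∑ t ∈ s.powerset, weight s p t * (b - ∑ i ∈ s, if t = {i} then b - a i else 0) :=
        Finset.sum_le_sum fun t ht =>
          mul_le_mul_of_nonneg_left (key t ht) (weight_nonneg h0 h1 t)
    _ = b - ∑ i ∈ s, weight s p {i} * (b - a i) := by
        have e : ∑ t ∈ s.powerset, weight s p t * (∑ i ∈ s, if t = {i} then b - a i else 0) =
            ∑ i ∈ s, weight s p {i} * (b - a i) := by
          simp only [Finset.mul_sum]
          rw [Finset.sum_comm]
          refine Finset.sum_congr rfl fun i hi => ?_
          simp only [mul_ite, mul_zero]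
          rw [Finset.sum_ite_eq' s.powerset ({i} : Finset ℕ), if_pos]
          simpa using hi
        rw [← e]
        simp only [mul_sub, Finset.sum_sub_distrib, ← Finset.sum_mul, sum_weight, one_mul]

/-! ### Quantities accumulated over the slots -/

/-- The sum of `f` over all slots of a history. -/
def total (f : History → SlotRecord → ℝ) : History → ℝ
  | [] => 0
  | r :: h => total f h + f h r

/-- The expected number of broadcasting nodes in the slot that follows `h`, if `k` nodes are
injected. -/
def contention (A : Algorithm) (h : History) (k : ℕ) : ℝ :=
  ∑ i ∈ activeNodes h k, (A (localView i h) : ℝ)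

/-- A lower bound for the conditional success probability of a slot. -/
def successRate (A : Algorithm) (h : History) (r : SlotRecord) : ℝ :=
  if r.jammed then 0
  else contention A h r.arrivals * Real.exp (-(2 * contention A h r.arrivals))

theorem prob_nonneg (A : Algorithm) (v : List Observation) : 0 ≤ (A v : ℝ) := (A v).2.1

theorem prob_le_one (A : Algorithm) (v : List Observation) : (A v : ℝ) ≤ 1 := (A v).2.2

theorem contention_nonneg (A : Algorithm) (h : History) (k : ℕ) : 0 ≤ contention A h k :=
  Finset.sum_nonneg fun _ _ => prob_nonneg A _

theorem successRate_nonneg (A : Algorithm) (h : History) (r : SlotRecord) :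
    0 ≤ successRate A h r := by
  unfold successRate
  split_ifs
  · exact le_rfl
  · exact mul_nonneg (contention_nonneg A h _) (Real.exp_pos _).le

/-- The excess of half the success rate over the number of successes, in the slots selected
by `φ`. -/
def successDeficit (A : Algorithm) (φ : History → Prop) : History → ℝ :=
  open Classical in total fun h r =>
    if φ h then successRate A h r / 2 - (if r.success then 1 else 0) else 0

/-- The selection `φ` depends only on the past of the slot, so it is predictable and skipped slots
change nothing. In a selected unjammed slot the success probability is at least `ρ`, and
`exp_half_mul_le` applies. -/
theorem isSupermartingale_successDeficit {A : Algorithm} (hA : ∀ v, (A v : ℝ) ≤ 1 / 2)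
    (φ : History → Prop) :
    IsSupermartingale A fun h => Real.exp (successDeficit A φ h) := by
  refine ⟨fun h => (Real.exp_pos _).le, fun h k J => ?_⟩
  have hstep : ∀ r : SlotRecord, Real.exp (successDeficit A φ (r :: h)) =
      Real.exp (successDeficit A φ h) * Real.exp (open Classical in
        if φ h then successRate A h r / 2 - (if r.success then 1 else 0) else 0) := by
    intro r
    rw [← Real.exp_add]
    rfl
  set w := Real.exp (successDeficit A φ h) with hw
  have hw0 : 0 < w := Real.exp_pos _
  simp only [hstep]
  by_cases hφ : φ h
  swap
  · simp only [hφ, if_false, Real.exp_zero, mul_one]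
    rw [← Finset.sum_mul, sum_weight, one_mul]
  cases J with
  | true =>
    simp only [hφ, successRate, SlotRecord.success, if_true]
    simp only [Bool.not_true, Bool.false_and, Bool.false_eq_true, if_false, zero_div, sub_zero,
      Real.exp_zero, mul_one]
    rw [← Finset.sum_mul, sum_weight, one_mul]
  | false =>
    set Y := contention A h k with hY
    have hρ : ∀ t, successRate A h ⟨k, false, t⟩ = Y * Real.exp (-(2 * Y)) := by
      intro t
      simp [successRate, hY]
    set ρ := Y * Real.exp (-(2 * Y)) with hρd
    have hρ0 : 0 ≤ ρ := mul_nonneg (contention_nonneg A h k) (Real.exp_pos _).le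
    simp only [hφ, if_true, hρ, SlotRecord.success]
    refine (sum_weight_mul_le (fun i => prob_nonneg A _) (fun i => prob_le_one A _)
      (b := w * Real.exp (ρ / 2)) (a := fun _ => w * Real.exp (ρ / 2) * Real.exp (-1))
      (fun t _ ht => by simp [ht]) (fun i _ => ?_)).trans ?_
    · simp [sub_eq_add_neg, Real.exp_add, mul_assoc]
    · rw [← Finset.sum_mul]
      have hP : ρ ≤ ∑ i ∈ activeNodes h k,
          weight (activeNodes h k) (fun i => (A (localView i h) : ℝ)) {i} := by
        rw [hρd, hY, contention, Finset.sum_mul]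
        exact Finset.sum_le_sum fun i _ =>
          mul_exp_le_weight_singleton (p := fun i => (A (localView i h) : ℝ))
            (fun j => prob_nonneg A _) (fun j => hA _) i
      have := mul_le_mul_of_nonneg_left (exp_half_mul_le hρ0 hP) hw0.le
      linarith

/-- The surplus of node `i`: half the lower bounds for its success probabilities in the slots of low
contention, less one if it has succeeded. -/
def nodeDeficit (A : Algorithm) (i : ℕ) : History → ℝ :=
  total fun h r =>
    if i ∈ activeNodes h r.arrivals then
      (if r.jammed = false ∧ contention A h r.arrivals ≤ 2 then
        Real.exp (-4) * (A (localView i h) : ℝ) / 2 else 0) -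
      (if r.success = true ∧ i ∈ r.senders then 1 else 0)
    else 0

/-- Successes of different nodes in one slot are disjoint events, hence negatively dependent, so the
expectation of the product is at most the product of one-node expectations, each controlled by
`exp_half_mul_le`. The parameter `z` sets the scale: the factor of a node matters once `exp
(nodeDeficit)` is comparable to `1 / z`. -/
theorem isSupermartingale_prod_nodeDeficit {A : Algorithm} (hA : ∀ v, (A v : ℝ) ≤ 1 / 2)
    (n : ℕ) {z : ℝ} (hz : 0 ≤ z) :
    IsSupermartingale A fun h =>
      ∏ i ∈ Finset.range n, (1 + z * Real.exp (nodeDeficit A i h)) := by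
  have hpos : ∀ x : ℝ, 0 < 1 + z * Real.exp x := fun x => by positivity
  refine ⟨fun h => Finset.prod_nonneg fun i _ => (hpos _).le, fun h k J => ?_⟩
  set s := activeNodes h k with hs
  set p : ℕ → ℝ := fun i => (A (localView i h) : ℝ) with hp
  cases J with
  | true =>
    have : ∀ t i, nodeDeficit A i (⟨k, true, t⟩ :: h) = nodeDeficit A i h := by
      intro t i
      simp [nodeDeficit, total, SlotRecord.success]
    simp only [this]
    rw [← Finset.sum_mul, sum_weight, one_mul]
  | false =>
    set x : ℕ → ℝ := fun i => if i ∈ s ∧ contention A h k ≤ 2 then Real.exp (-4) * p i / 2 else 0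
      with hx
    set γ : ℕ → ℝ := fun i => nodeDeficit A i h with hγ
    set y : ℕ → ℝ := fun i => if i ∈ s then weight s p {i} else 0 with hy
    have hp0 : ∀ i, 0 ≤ p i := fun i => prob_nonneg A _
    have hp1 : ∀ i, p i ≤ 1 := fun i => prob_le_one A _
    have hstep : ∀ t i, nodeDeficit A i (⟨k, false, t⟩ :: h) =
        γ i + x i - if i ∈ s ∧ t.card = 1 ∧ i ∈ t then 1 else 0 := by
      intro t i
      by_cases hi : i ∈ s
      · simp [nodeDeficit, total, SlotRecord.success, hx, hγ, ← hs, hi, hp, add_sub_assoc]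
      · simp [nodeDeficit, total, hx, hγ, ← hs, hi]
    set R := ∏ i ∈ Finset.range n, (1 + z * Real.exp (γ i + x i)) with hR
    have hR0 : 0 < R := Finset.prod_pos fun i _ => hpos _
    -- The relative loss of the whole product when node `i` succeeds; nodes outside the product
    -- cause none.
    set δ : ℕ → ℝ := fun i => if i < n then
      1 - (1 + z * Real.exp (γ i + x i - 1)) / (1 + z * Real.exp (γ i + x i)) else 0 with hδ
    have hδ0 : ∀ i, 0 ≤ δ i := by
      intro i
      simp only [hδ]
      split_ifs
      · rw [sub_nonneg, div_le_one (hpos _)]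
        gcongr
        linarith
      · exact le_rfl
    have hδ1 : ∀ i, δ i ≤ 1 := by
      intro i
      simp only [hδ]
      split_ifs
      · rw [sub_le_self_iff]
        exact div_nonneg (hpos _).le (hpos _).le
      · exact zero_le_one
    have hy0 : ∀ i, 0 ≤ y i := fun i => by
      simp only [hy]
      split_ifs
      exacts [weight_nonneg hp0 hp1 _, le_rfl]
    have hy1 : ∀ i, y i ≤ 1 := fun i => by
      simp only [hy]
      split_ifs
      exacts [weight_singleton_le_one hp0 hp1 _, zero_le_one]
    refine (sum_weight_mul_le hp0 hp1 (b := R) (a := fun i => R * (1 - δ i))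
      (fun t _ ht => ?_) (fun j hj => ?_)).trans ?_
    · simp [hstep, ht, hR]
    · simp only [hstep, Finset.card_singleton, Finset.mem_singleton, true_and]
      by_cases hjn : j < n
      · have hj' := Finset.mem_range.2 hjn
        rw [hR, ← Finset.mul_prod_erase _ _ hj', ← Finset.mul_prod_erase _ _ hj']
        have h1 : ∏ i ∈ (Finset.range n).erase j,
            (1 + z * Real.exp (γ i + x i - if i ∈ s ∧ i = j then 1 else 0)) =
            ∏ i ∈ (Finset.range n).erase j, (1 + z * Real.exp (γ i + x i)) := by
          refine Finset.prod_congr rfl fun i hi => ?_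
          rw [if_neg fun h => (Finset.mem_erase.1 hi).1 h.2, sub_zero]
        rw [h1, if_pos ⟨hj, rfl⟩]
        simp only [hδ, hjn, if_true, sub_sub_cancel]
        have := (hpos (γ j + x j)).ne'
        field_simp
        exact le_rfl
      · simp only [hδ, hjn, if_false, sub_zero, mul_one, hR]
        refine (Finset.prod_congr rfl fun i hi => ?_).le
        rw [if_neg, sub_zero]
        rintro ⟨_, rfl⟩
        exact hjn (Finset.mem_range.1 hi)
    · have e1 : ∑ i ∈ s, weight s p {i} * (R - R * (1 - δ i)) =
          R * ∑ i ∈ s, y i * δ i := by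
        rw [Finset.mul_sum]
        refine Finset.sum_congr rfl fun i hi => ?_
        simp only [hy, hi, if_true]
        ring
      have e2 : ∑ i ∈ Finset.range n, y i * δ i ≤ ∑ i ∈ s, y i * δ i := by
        rw [← Finset.sum_filter_add_sum_filter_not (Finset.range n) (· ∈ s),
          Finset.sum_eq_zero (s := (Finset.range n).filter (· ∉ s)), add_zero]
        · refine Finset.sum_le_sum_of_subset_of_nonneg (fun i hi => (Finset.mem_filter.1 hi).2)
            fun i _ _ => mul_nonneg (hy0 i) (hδ0 i)
        · intro i hi
          simp only [hy, (Finset.mem_filter.1 hi).2, if_false, zero_mul]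
      -- This is where disjointness of the successes is traded for a product over nodes.
      have e3 := one_sub_sum_le_prod (Finset.range n) (fun i => y i * δ i)
        (fun i _ => mul_nonneg (hy0 i) (hδ0 i)) (fun i _ => mul_le_one₀ (hy1 i) (hδ0 i) (hδ1 i))
      calc R - ∑ i ∈ s, weight s p {i} * (R - R * (1 - δ i))
          = R * (1 - ∑ i ∈ s, y i * δ i) := by rw [e1]; ring
        _ ≤ R * ∏ i ∈ Finset.range n, (1 - y i * δ i) := by
            gcongr
            linarith
        _ = ∏ i ∈ Finset.range n, (1 + z * Real.exp (γ i + x i)) * (1 - y i * δ i) := by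
            rw [hR, Finset.prod_mul_distrib]
        _ ≤ ∏ i ∈ Finset.range n, (1 + z * Real.exp (γ i)) := by
            refine Finset.prod_le_prod (fun i _ => mul_nonneg (hpos _).le
              (sub_nonneg.2 (mul_le_one₀ (hy1 i) (hδ0 i) (hδ1 i)))) fun i hi => ?_
            have hi' := Finset.mem_range.1 hi
            -- Contention at most 2 gives singleton probability at least `e⁻⁴ p i`, of which `x i`
            -- is half.
            have hxy : 2 * x i ≤ y i := by
              simp only [hx, hy]
              by_cases his : i ∈ s
              · by_cases hc : contention A h k ≤ 2
                · simp only [his, hc, true_and, if_true]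
                  have := mul_exp_le_weight_singleton (s := s) hp0 (fun j => hA _) i
                  refine le_trans ?_ this
                  have hc' : Real.exp (-4) ≤ Real.exp (-(2 * ∑ j ∈ s, p j)) := by
                    rw [Real.exp_le_exp]
                    have : ∑ j ∈ s, p j = contention A h k := rfl
                    linarith
                  nlinarith [mul_le_mul_of_nonneg_left hc' (hp0 i)]
                · simp only [hc, and_false, if_false, his, if_true, mul_zero]
                  exact weight_nonneg hp0 hp1 _
              · simp [his]
            have hx0 : 0 ≤ x i := by
              simp only [hx]
              split_ifs
              · have := hp0 i; positivity
              · exact le_rfl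
            have h1 := exp_half_mul_le (x := 2 * x i) (by linarith) hxy
            rw [mul_div_cancel_left₀ _ (two_ne_zero' ℝ)] at h1
            simp only [hδ, hi', if_true]
            have h2 := mul_le_mul_of_nonneg_left h1 (mul_nonneg hz (Real.exp_pos (γ i)).le)
            have h3 : (1 + z * Real.exp (γ i + x i)) * (1 - y i *
                (1 - (1 + z * Real.exp (γ i + x i - 1)) / (1 + z * Real.exp (γ i + x i)))) =
                1 + z * Real.exp (γ i) *
                  (Real.exp (x i) * (1 - y i * (1 - Real.exp (-1)))) := by
              have := (hpos (γ i + x i)).ne'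
              field_simp
              rw [show γ i + x i - 1 = γ i + x i + -1 by ring, Real.exp_add (γ i + x i),
                Real.exp_add (γ i)]
              ring
            rw [h3]
            linarith

/-- The expected energy of node `i`. -/
def expectedAttempts (A : Algorithm) (i : ℕ) : History → ℝ :=
  total fun h r => if i ∈ activeNodes h r.arrivals then (A (localView i h) : ℝ) else 0

/-- The exponential moment of one broadcast decision is `1 + p (e - 1) ≤ exp (2p)`. -/
theorem isSupermartingale_attempts (A : Algorithm) (i : ℕ) :
    IsSupermartingale A fun h =>
      Real.exp (attempts i h - 2 * expectedAttempts A i h) := by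
  refine ⟨fun h => (Real.exp_pos _).le, fun h k J => ?_⟩
  set s := activeNodes h k with hs
  set p : ℕ → ℝ := fun i => (A (localView i h) : ℝ) with hp
  set w := Real.exp (attempts i h - 2 * expectedAttempts A i h) with hw
  have hw0 : 0 < w := Real.exp_pos _
  have hp0 : ∀ i, 0 ≤ p i := fun i => prob_nonneg A _
  by_cases hi : i ∈ s
  · have hstep : ∀ t, Real.exp (attempts i (⟨k, J, t⟩ :: h) -
        2 * expectedAttempts A i (⟨k, J, t⟩ :: h)) =
        w * Real.exp (-(2 * p i)) * if i ∈ t then Real.exp 1 else 1 := by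
      intro t
      rw [hw, ← Real.exp_add]
      by_cases hit : i ∈ t
      · simp only [hit, if_true]
        rw [← Real.exp_add]
        congr 1
        simp [attempts, expectedAttempts, total, hit, ← hs, hi, hp]
        ring
      · simp only [hit, if_false, mul_one]
        congr 1
        simp [attempts, expectedAttempts, total, hit, ← hs, hi, hp]
        ring
    simp only [hstep]
    have hsum : ∑ t ∈ s.powerset, weight s p t * (if i ∈ t then Real.exp 1 else 1) =
        1 + p i * (Real.exp 1 - 1) := by
      have h1 : ∀ t ∈ s.powerset, weight s p t * (if i ∈ t then Real.exp 1 else 1) =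
          (∏ j ∈ t, p j * if j = i then Real.exp 1 else 1) * ∏ j ∈ s \ t, (1 - p j) := by
        intro t _
        rw [Finset.prod_mul_distrib, Finset.prod_ite_eq', weight]
        ring
      rw [Finset.sum_congr rfl h1, ← Finset.prod_add, ← Finset.mul_prod_erase _ _ hi,
        Finset.prod_eq_one (s := s.erase i)]
      · simp
        ring
      · intro j hj
        simp [(Finset.mem_erase.1 hj).1]
    have h2 : ∀ t, weight s p t * (w * Real.exp (-(2 * p i)) * if i ∈ t then Real.exp 1 else 1) =
        w * Real.exp (-(2 * p i)) * (weight s p t * if i ∈ t then Real.exp 1 else 1) :=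
      fun t => by ring
    simp only [h2]
    rw [← Finset.mul_sum, hsum, mul_assoc]
    refine mul_le_of_le_one_right hw0.le ?_
    rw [Real.exp_neg, inv_mul_le_one₀ (Real.exp_pos _)]
    have h3 := Real.add_one_le_exp (2 * p i)
    have h4 := Real.exp_one_lt_d9
    nlinarith [hp0 i]
  · have hstep : ∀ t ∈ s.powerset, weight s p t * Real.exp (attempts i (⟨k, J, t⟩ :: h) -
        2 * expectedAttempts A i (⟨k, J, t⟩ :: h)) = weight s p t * w := by
      intro t ht
      have hit : i ∉ t := fun h => hi (Finset.mem_powerset.1 ht h)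
      simp [hw, attempts, expectedAttempts, total, hit, ← hs, hi]
    rw [Finset.sum_congr rfl hstep, ← Finset.sum_mul, sum_weight, one_mul]

/-! ### The algorithm -/

/-- The low broadcast probability of a node of age `a`. -/
def lowRate (a : ℕ) : ℝ := 1 / ((a : ℝ) + 3)

/-- The high broadcast probability of a node of age `a`. -/
def highRate (a : ℕ) : ℝ := Real.log ((a : ℝ) + 3) / ((a : ℝ) + 3)

theorem lowRate_pos (a : ℕ) : 0 < lowRate a := by
  unfold lowRate
  positivity

theorem one_le_log_age (a : ℕ) : 1 ≤ Real.log ((a : ℝ) + 3) := by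
  rw [Real.le_log_iff_exp_le (by positivity)]
  have := Real.exp_one_lt_d9
  have : (0 : ℝ) ≤ a := Nat.cast_nonneg a
  linarith

theorem highRate_eq (a : ℕ) : highRate a = Real.log ((a : ℝ) + 3) * lowRate a := by
  unfold highRate lowRate
  ring

theorem lowRate_le_highRate (a : ℕ) : lowRate a ≤ highRate a := by
  rw [highRate_eq]
  exact le_mul_of_one_le_left (lowRate_pos a).le (one_le_log_age a)

theorem highRate_pos (a : ℕ) : 0 < highRate a := (lowRate_pos a).trans_le (lowRate_le_highRate a)

theorem antitone_highRate : Antitone highRate := by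
  intro a b hab
  have h1 : Real.exp 1 ≤ (a : ℝ) + 3 := by
    have := Real.exp_one_lt_d9
    have : (0 : ℝ) ≤ a := Nat.cast_nonneg a
    linarith
  have hab' : (a : ℝ) + 3 ≤ (b : ℝ) + 3 := by
    have : (a : ℝ) ≤ b := by exact_mod_cast hab
    linarith
  exact Real.log_div_self_antitoneOn h1 (h1.trans hab') hab'

theorem antitone_lowRate : Antitone lowRate := by
  intro a b hab
  unfold lowRate
  gcongr

theorem highRate_le_half (a : ℕ) : highRate a ≤ 1 / 2 := by
  unfold highRate
  rw [div_le_iff₀ (by positivity)]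
  have h1 := Real.log_le_sub_one_of_pos (x := ((a : ℝ) + 3) / 2) (by positivity)
  rw [Real.log_div (by positivity) two_ne_zero] at h1
  have := Real.log_two_lt_d9
  linarith

/-- The worst case is age 0. Masses thus lose at most a quarter from one slot to the next if nobody
leaves, which transfers congestion from an odd slot to the following even one. -/
theorem lowRate_succ (a : ℕ) : 3 / 4 * lowRate a ≤ lowRate (a + 1) := by
  unfold lowRate
  rw [mul_one_div, div_le_div_iff₀ (by positivity) (by positivity)]
  push_cast
  have : (0 : ℝ) ≤ a := Nat.cast_nonneg a
  linarith

theorem highRate_succ (a : ℕ) : 3 / 4 * highRate a ≤ highRate (a + 1) := by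
  rw [highRate_eq, highRate_eq]
  have h1 : Real.log ((a : ℝ) + 3) ≤ Real.log (((a + 1 : ℕ) : ℝ) + 3) := by
    apply Real.log_le_log (by positivity)
    push_cast
    linarith
  calc 3 / 4 * (Real.log ((a : ℝ) + 3) * lowRate a)
      = Real.log ((a : ℝ) + 3) * (3 / 4 * lowRate a) := by ring
    _ ≤ _ := mul_le_mul h1 (lowRate_succ a) (by have := lowRate_pos a; positivity)
        ((zero_le_one.trans (one_le_log_age a)).trans h1)

/-- The number of slots since the last success that a node has observed. -/
def gap : List Observation → ℕ
  | [] => 0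
  | o :: v => if o.heard then 0 else gap v + 1

/-- The broadcast probability: low in the slots at even distance from the last success, provided a
success has been observed at all, and high otherwise. -/
def backoffProb (v : List Observation) : ℝ :=
  if gap v < v.length ∧ Even (gap v) then lowRate v.length else highRate v.length

theorem backoffProb_nonneg (v : List Observation) : 0 ≤ backoffProb v := by
  unfold backoffProb
  split_ifs
  exacts [(lowRate_pos _).le, (highRate_pos _).le]

theorem backoffProb_le_highRate (v : List Observation) : backoffProb v ≤ highRate v.length := by
  unfold backoffProb
  split_ifs
  exacts [lowRate_le_highRate _, le_rfl]

/-- Backoff with two alternating rates, synchronized by the successes. -/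
def backoff : Algorithm := fun v =>
  ⟨backoffProb v, backoffProb_nonneg v, by
    linarith [backoffProb_le_highRate v, highRate_le_half v.length]⟩

theorem coe_backoff (v : List Observation) : (backoff v : ℝ) = backoffProb v := rfl

theorem backoff_le_half (v : List Observation) : (backoff v : ℝ) ≤ 1 / 2 :=
  (backoffProb_le_highRate v).trans (highRate_le_half _)

/-! ### Ages, gaps and successes in a history -/

/-- The number of slots since the arrival of node `i`. -/
def age (i : ℕ) (h : History) : ℕ := (localView i h).length

/-- The number of slots since the last success. -/
def globalGap : History → ℕ
  | [] => 0
  | r :: h => if r.success then 0 else globalGap h + 1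

/-- The number of successes so far. -/
def successes : History → ℕ
  | [] => 0
  | r :: h => successes h + if r.success then 1 else 0

theorem age_cons (i : ℕ) (r : SlotRecord) (h : History) :
    age i (r :: h) = if i < injected h + r.arrivals then age i h + 1 else 0 := by
  unfold age
  rw [localView]
  split_ifs <;> simp

theorem age_eq_zero {i : ℕ} {h : History} (hi : injected h ≤ i) : age i h = 0 := by
  cases h with
  | nil => rfl
  | cons r h =>
    rw [age_cons, if_neg]
    simpa [injected] using hi

/-- A node counts from its arrival or from the last success, whichever is later. -/
theorem gap_localView (i : ℕ) (h : History) :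
    gap (localView i h) = min (globalGap h) (age i h) := by
  induction h with
  | nil => rfl
  | cons r h ih =>
    rw [age_cons, localView, globalGap]
    split_ifs with h1 h2 h2
    · simp [gap, h2]
    · simp [gap, h2, ih, Nat.add_min_add_right]
    · simp [gap]
    · simp [gap]

/-- No success has occurred since the arrival of the node. -/
def Fresh (i : ℕ) (h : History) : Prop := age i h ≤ globalGap h

/-- All nodes that are not fresh see the same `globalGap`, so their rates alternate in step. -/
theorem backoff_localView (i : ℕ) (h : History) :
    (backoff (localView i h) : ℝ) =
      open Classical in if ¬ Fresh i h ∧ Even (globalGap h) then lowRate (age i h)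
        else highRate (age i h) := by
  have hlen : (localView i h).length = age i h := rfl
  rw [coe_backoff, backoffProb, gap_localView, hlen]
  unfold Fresh
  by_cases h1 : age i h ≤ globalGap h
  · rw [if_neg, if_neg]
    · tauto
    · rw [min_eq_right h1]
      simp
  · rw [min_eq_left (by omega)]
    congr 1
    simp only [h1, not_false_eq_true, true_and, eq_iff_iff, and_iff_right_iff_imp]
    omega

theorem remaining_subset (h : History) : remaining h ⊆ Finset.range (injected h) := by
  induction h with
  | nil => simp [remaining]
  | cons r h ih =>
    have : remaining h ∪ Finset.Ico (injected h) (injected h + r.arrivals) ⊆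
        Finset.range (injected h + r.arrivals) := by
      refine Finset.union_subset (ih.trans ?_) ?_
      · intro x; simp; omega
      · intro x; simp
    rw [remaining, injected]
    split_ifs
    · exact Finset.sdiff_subset.trans this
    · exact this

theorem lt_of_mem_activeNodes {i k : ℕ} {h : History} (hi : i ∈ activeNodes h k) :
    i < injected h + k := by
  unfold activeNodes at hi
  rcases Finset.mem_union.1 hi with hi | hi
  · have := Finset.mem_range.1 (remaining_subset h hi)
    omega
  · exact (Finset.mem_Ico.1 hi).2

theorem remaining_cons (r : SlotRecord) (h : History) :
    remaining (r :: h) = if r.success then activeNodes h r.arrivals \ r.senders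
      else activeNodes h r.arrivals := rfl

/-- Only active nodes broadcast. -/
def Valid : History → Prop
  | [] => True
  | r :: h => Valid h ∧ r.senders ⊆ activeNodes h r.arrivals

theorem card_activeNodes (h : History) (k : ℕ) :
    (activeNodes h k).card = (remaining h).card + k := by
  unfold activeNodes
  rw [Finset.card_union_of_disjoint, Nat.card_Ico, Nat.add_sub_cancel_left]
  rw [Finset.disjoint_left]
  intro x hx hx'
  have := Finset.mem_range.1 (remaining_subset h hx)
  have := (Finset.mem_Ico.1 hx').1
  omega

theorem successes_add_card_remaining {h : History} (hv : Valid h) :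
    successes h + (remaining h).card = injected h := by
  induction h with
  | nil => rfl
  | cons r h ih =>
    have ih' := ih hv.1
    have hc := card_activeNodes h r.arrivals
    rw [successes, injected, remaining_cons]
    split_ifs with hs
    · have h1 : r.senders.card = 1 := by
        simp [SlotRecord.success] at hs
        exact hs.2
      have h2 := Finset.card_sdiff_add_card_eq_card hv.2
      omega
    · omega

theorem valid_of_mem_support {A : Algorithm} {E : Adversary} {T : ℕ} {h : History}
    (hh : h ∈ (execution A E T).support) : Valid h := by
  induction T generalizing h with
  | zero =>
    simp [execution] at hh
    subst hh
    trivial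
  | succ T ih =>
    simp only [execution, PMF.mem_support_bind_iff, PMF.mem_support_map_iff, nextSlot] at hh
    obtain ⟨h', hh', r, ⟨a, _, t, ht, rfl⟩, rfl⟩ := hh
    refine ⟨ih hh', ?_⟩
    by_contra hn
    apply (PMF.mem_support_iff _ _).1 ht
    simp only [senderSet, PMF.ofFinset_apply]
    exact if_neg hn

theorem Valid.suffix {s h : History} (hs : s <:+ h) (hv : Valid h) : Valid s := by
  induction h with
  | nil => rwa [List.suffix_nil.1 hs]
  | cons r h ih =>
    rcases List.suffix_cons_iff.1 hs with rfl | hs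
    exacts [hv, ih hs hv.1]

theorem injected_le_of_suffix {s h : History} (hs : s <:+ h) : injected s ≤ injected h := by
  induction h with
  | nil => rw [List.suffix_nil.1 hs]
  | cons r h ih =>
    rcases List.suffix_cons_iff.1 hs with rfl | hs
    · exact le_rfl
    · exact (ih hs).trans (Nat.le_add_right _ _)

theorem jams_le_of_suffix {s h : History} (hs : s <:+ h) : jams s ≤ jams h := by
  induction h with
  | nil => rw [List.suffix_nil.1 hs]
  | cons r h ih =>
    rcases List.suffix_cons_iff.1 hs with rfl | hs
    · exact le_rfl
    · exact (ih hs).trans (Nat.le_add_right _ _)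

theorem exists_suffix_activeSlots_eq {h : History} {N : ℕ} (hN : N ≤ activeSlots h) :
    ∃ s, s <:+ h ∧ activeSlots s = N := by
  induction h with
  | nil =>
    have : N = 0 := by simpa [activeSlots] using hN
    exact ⟨[], List.suffix_rfl, this.symm⟩
  | cons r h ih =>
    by_cases h1 : N ≤ activeSlots h
    · obtain ⟨s, hs, hs'⟩ := ih h1
      exact ⟨s, hs.trans (List.suffix_cons r h), hs'⟩
    · refine ⟨r :: h, List.suffix_rfl, ?_⟩
      rw [activeSlots] at hN ⊢
      split_ifs at hN ⊢ <;> omega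

theorem attempts_eq_zero {h : History} (hv : Valid h) {i : ℕ} (hi : injected h ≤ i) :
    attempts i h = 0 := by
  induction h with
  | nil => rfl
  | cons r h ih =>
    rw [injected] at hi
    rw [attempts, ih hv.1 (by omega), if_neg]
    intro hmem
    have := lt_of_mem_activeNodes (hv.2 hmem)
    omega

/-! ### Traces -/

/-- The history of the first `t` slots of a sequence of slots. -/
def hist (rec : ℕ → SlotRecord) : ℕ → History
  | 0 => []
  | t + 1 => rec t :: hist rec t

theorem hist_congr {rec rec' : ℕ → SlotRecord} {H : ℕ} (h : ∀ t < H, rec t = rec' t) :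
    hist rec H = hist rec' H := by
  induction H with
  | zero => rfl
  | succ H ih =>
    rw [hist, hist, h H (Nat.lt_succ_self H), ih fun t ht => h t (by omega)]

/-- Turns a list into a sequence indexed by time, so that accumulated quantities become finite sums
over slots. -/
theorem exists_hist_eq (h : History) : ∃ rec, hist rec h.length = h := by
  induction h with
  | nil => exact ⟨fun _ => ⟨0, false, ∅⟩, rfl⟩
  | cons r h ih =>
    obtain ⟨rec, hrec⟩ := ih
    refine ⟨fun t => if t = h.length then r else rec t, ?_⟩
    rw [List.length_cons, hist, if_pos rfl]
    congr 1
    exact (hist_congr fun t ht => if_neg (by omega)).trans hrec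

theorem total_hist (f : History → SlotRecord → ℝ) (rec : ℕ → SlotRecord) (H : ℕ) :
    total f (hist rec H) = ∑ t ∈ Finset.range H, f (hist rec t) (rec t) := by
  induction H with
  | zero => rfl
  | succ H ih => rw [hist, total, ih, Finset.sum_range_succ]

/-- The nodes active in slot `t`. -/
def act (rec : ℕ → SlotRecord) (t : ℕ) : Finset ℕ := activeNodes (hist rec t) (rec t).arrivals

theorem activeSlots_hist (rec : ℕ → SlotRecord) (H : ℕ) :
    activeSlots (hist rec H) = ((Finset.range H).filter fun t => (act rec t).Nonempty).card := by
  induction H with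
  | zero => rfl
  | succ H ih =>
    rw [hist, activeSlots, ih, Finset.card_filter, Finset.card_filter, Finset.sum_range_succ]
    rfl

theorem jams_hist (rec : ℕ → SlotRecord) (H : ℕ) :
    jams (hist rec H) = ((Finset.range H).filter fun t => (rec t).jammed = true).card := by
  induction H with
  | zero => rfl
  | succ H ih =>
    rw [hist, jams, ih, Finset.card_filter, Finset.card_filter, Finset.sum_range_succ]

theorem successes_hist (rec : ℕ → SlotRecord) (H : ℕ) :
    successes (hist rec H) = ((Finset.range H).filter fun t => (rec t).success = true).card := by
  induction H with
  | zero => rfl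
  | succ H ih =>
    rw [hist, successes, ih, Finset.card_filter, Finset.card_filter, Finset.sum_range_succ]

theorem hist_suffix (rec : ℕ → SlotRecord) {s t : ℕ} (h : s ≤ t) :
    hist rec s <:+ hist rec t := by
  induction t, h using Nat.le_induction with
  | base => exact List.suffix_rfl
  | succ t _ ih => exact ih.trans (List.suffix_cons _ _)

theorem lt_injected_of_mem_act {rec : ℕ → SlotRecord} {t i : ℕ} (h : i ∈ act rec t) :
    i < injected (hist rec (t + 1)) := lt_of_mem_activeNodes h

theorem mem_act_succ {rec : ℕ → SlotRecord} {t i : ℕ} (h : i ∈ act rec t)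
    (hs : ¬ ((rec t).success = true ∧ i ∈ (rec t).senders)) : i ∈ act rec (t + 1) := by
  unfold act at h ⊢
  rw [hist]
  rw [activeNodes, remaining_cons]
  apply Finset.mem_union_left
  split_ifs with h1
  · exact Finset.mem_sdiff.2 ⟨h, fun h2 => hs ⟨h1, h2⟩⟩
  · exact h

theorem age_succ {rec : ℕ → SlotRecord} {t i : ℕ} (h : i < injected (hist rec (t + 1))) :
    age i (hist rec (t + 1)) = age i (hist rec t) + 1 := by
  rw [hist, age_cons]
  exact if_pos h

theorem mem_act_of_mem_act_succ {rec : ℕ → SlotRecord} {t i : ℕ} (h : i ∈ act rec (t + 1))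
    (ha : age i (hist rec (t + 1)) ≠ 0) :
    i ∈ act rec t ∧ age i (hist rec (t + 1)) = age i (hist rec t) + 1 := by
  have h1 : i < injected (hist rec (t + 1)) := by
    by_contra hn
    exact ha (age_eq_zero (not_lt.1 hn))
  refine ⟨?_, age_succ h1⟩
  unfold act at h
  rw [activeNodes, Finset.mem_union] at h
  rcases h with h | h
  · rw [hist, remaining_cons] at h
    split_ifs at h
    · exact (Finset.mem_sdiff.1 h).1
    · exact h
  · exact absurd (Finset.mem_Ico.1 h).1 (not_le.2 h1)

theorem not_mem_act_of_success {rec : ℕ → SlotRecord} {t i : ℕ} (h : i ∈ act rec t)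
    (hs : (rec t).success = true) (hi : i ∈ (rec t).senders) : i ∉ act rec (t + 1) := by
  intro h2
  have h1 := lt_injected_of_mem_act h
  unfold act at h2
  rw [activeNodes, Finset.mem_union] at h2
  rcases h2 with h2 | h2
  · rw [hist, remaining_cons, if_pos hs] at h2
    exact (Finset.mem_sdiff.1 h2).2 hi
  · exact absurd (Finset.mem_Ico.1 h2).1 (not_le.2 h1)

theorem age_add {rec : ℕ → SlotRecord} {t i : ℕ} (h : i ∈ act rec t) (m : ℕ) :
    age i (hist rec (t + m)) = age i (hist rec t) + m := by
  induction m with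
  | zero => rfl
  | succ m ih =>
    rw [← add_assoc, age_succ, ih]
    · ring
    · exact (lt_injected_of_mem_act h).trans_le
        (injected_le_of_suffix (hist_suffix rec (by omega)))

theorem mem_act_sub {rec : ℕ → SlotRecord} {t i : ℕ} (h : i ∈ act rec t) {m : ℕ}
    (hm : m ≤ age i (hist rec t)) :
    m ≤ t ∧ i ∈ act rec (t - m) ∧ age i (hist rec (t - m)) + m = age i (hist rec t) := by
  induction m with
  | zero => simpa using h
  | succ m ih =>
    obtain ⟨h1, h2, h3⟩ := ih (by omega)
    have h4 : t - m ≠ 0 := by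
      intro h0
      rw [h0] at h3
      have : age i (hist rec 0) = 0 := rfl
      omega
    obtain ⟨u, hu⟩ := Nat.exists_eq_succ_of_ne_zero h4
    rw [hu] at h2 h3
    obtain ⟨h5, h6⟩ := mem_act_of_mem_act_succ h2 (by
      have : age i (hist rec (u + 1)) + m = age i (hist rec t) := h3
      omega)
    have h7 : t - (m + 1) = u := by omega
    rw [h7]
    refine ⟨by omega, h5, ?_⟩
    have : age i (hist rec (u + 1)) + m = age i (hist rec t) := h3
    omega

theorem mem_act_between {rec : ℕ → SlotRecord} {i s t u : ℕ} (hs : i ∈ act rec s)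
    (hu : i ∈ act rec u) (hst : s ≤ t) (htu : t ≤ u) : i ∈ act rec t := by
  have h1 := age_add hs (u - s)
  rw [Nat.add_sub_cancel' (hst.trans htu)] at h1
  have h2 := (mem_act_sub hu (m := u - t) (by omega)).2.1
  rwa [Nat.sub_sub_self htu] at h2

/-- The slots before `H` in which node `i` is active. -/
def life (rec : ℕ → SlotRecord) (H i : ℕ) : Finset ℕ :=
  (Finset.range H).filter fun t => i ∈ act rec t

theorem mem_life {rec : ℕ → SlotRecord} {H i t : ℕ} :
    t ∈ life rec H i ↔ t < H ∧ i ∈ act rec t := by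
  simp [life]

/-- The lifetime of a node is an interval, on which its age counts from zero. -/
theorem exists_life_eq (rec : ℕ → SlotRecord) (H i : ℕ) :
    ∃ s, life rec H i = Finset.Ico s (s + (life rec H i).card) ∧
      ∀ t ∈ life rec H i, age i (hist rec t) = t - s := by
  by_cases hne : (life rec H i).Nonempty
  swap
  · rw [Finset.not_nonempty_iff_eq_empty] at hne
    exact ⟨0, by simp [hne]⟩
  set s := (life rec H i).min' hne with hs
  set e := (life rec H i).max' hne with he
  have hsm := mem_life.1 ((life rec H i).min'_mem hne)
  have hem := mem_life.1 ((life rec H i).max'_mem hne)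
  rw [← hs] at hsm
  rw [← he] at hem
  have hage : age i (hist rec s) = 0 := by
    by_contra h0
    obtain ⟨h1, h2, _⟩ := mem_act_sub hsm.2 (m := 1) (by omega)
    have := (life rec H i).min'_le _ (mem_life.2 ⟨by omega, h2⟩)
    omega
  have heq : life rec H i = Finset.Ico s (e + 1) := by
    ext t
    rw [Finset.mem_Ico]
    constructor
    · intro ht
      exact ⟨(life rec H i).min'_le _ ht, Nat.lt_succ_of_le ((life rec H i).le_max' _ ht)⟩
    · rintro ⟨h1, h2⟩
      exact mem_life.2 ⟨by omega, mem_act_between hsm.2 hem.2 h1 (by omega)⟩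
  have hse : s ≤ e := (life rec H i).min'_le _ ((life rec H i).max'_mem hne)
  refine ⟨s, ?_, fun t ht => ?_⟩
  · rw [heq, Nat.card_Ico]
    congr 1
    omega
  · have h1 := (life rec H i).min'_le _ ht
    have h2 := age_add hsm.2 (t - s)
    rw [Nat.add_sub_cancel' h1] at h2
    omega

theorem sum_success_le_one (rec : ℕ → SlotRecord) (H i : ℕ) :
    ∑ t ∈ life rec H i,
      (if (rec t).success = true ∧ i ∈ (rec t).senders then (1 : ℝ) else 0) ≤ 1 := by
  rw [← Finset.sum_filter, Finset.sum_const, nsmul_eq_mul, mul_one]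
  have : ((life rec H i).filter fun t => (rec t).success = true ∧ i ∈ (rec t).senders).card ≤ 1 := by
    rw [Finset.card_le_one]
    have key : ∀ a b, a < b → i ∈ act rec a → i ∈ act rec b →
        ¬ ((rec a).success = true ∧ i ∈ (rec a).senders) := by
      intro a b hab ha hb h
      exact not_mem_act_of_success ha h.1 h.2 (mem_act_between ha hb (by omega) hab)
    intro a ha b hb
    rw [Finset.mem_filter, mem_life] at ha hb
    rcases lt_trichotomy a b with h | h | h
    · exact absurd ha.2 (key a b h ha.1.2 hb.1.2)
    · exact h
    · exact absurd hb.2 (key b a h hb.1.2 ha.1.2)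
  exact_mod_cast this

/-! ### Sums of the rates -/

/-- Among sets of the same size an initial segment maximizes the sum. -/
theorem sum_le_sum_range_of_antitone {f : ℕ → ℝ} (hf : Antitone f) (A : Finset ℕ) :
    ∑ a ∈ A, f a ≤ ∑ a ∈ Finset.range A.card, f a := by
  induction A using Finset.induction_on_max with
  | empty => simp
  | insert m A hm ih =>
    have hmA : m ∉ A := fun h => lt_irrefl _ (hm m h)
    rw [Finset.sum_insert hmA, Finset.card_insert_of_notMem hmA, Finset.sum_range_succ, add_comm]
    refine add_le_add ih (hf ?_)
    have : A ⊆ Finset.range m := fun x hx => Finset.mem_range.2 (hm x hx)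
    simpa using Finset.card_le_card this

theorem lowRate_le_log_sub (a : ℕ) :
    lowRate a ≤ Real.log ((a : ℝ) + 3) - Real.log ((a : ℝ) + 2) := by
  have h := Real.log_le_sub_one_of_pos (x := ((a : ℝ) + 2) / (a + 3)) (by positivity)
  rw [Real.log_div (by positivity) (by positivity)] at h
  have : ((a : ℝ) + 2) / (a + 3) - 1 = -lowRate a := by
    unfold lowRate
    field_simp
    ring
  linarith

theorem log_sub_le_lowRate (a : ℕ) :
    Real.log (((a + 1 : ℕ) : ℝ) + 3) - Real.log ((a : ℝ) + 3) ≤ lowRate a := by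
  have h := Real.log_le_sub_one_of_pos (x := (((a + 1 : ℕ) : ℝ) + 3) / (a + 3)) (by positivity)
  rw [Real.log_div (by positivity) (by positivity)] at h
  have : (((a + 1 : ℕ) : ℝ) + 3) / (a + 3) - 1 = lowRate a := by
    unfold lowRate
    push_cast
    field_simp
    ring
  linarith

theorem sum_lowRate_le (m : ℕ) : ∑ a ∈ Finset.range m, lowRate a ≤ Real.log ((m : ℝ) + 3) := by
  have h : ∑ a ∈ Finset.range m, lowRate a ≤ Real.log ((m : ℝ) + 2) := by
    induction m with
    | zero => simp; exact Real.log_nonneg (by norm_num)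
    | succ m ih =>
      rw [Finset.sum_range_succ]
      have := lowRate_le_log_sub m
      push_cast
      rw [show (m : ℝ) + 1 + 2 = m + 3 by ring]
      linarith
  refine h.trans (Real.log_le_log (by positivity) (by linarith))

theorem sum_highRate_le (m : ℕ) :
    ∑ a ∈ Finset.range m, highRate a ≤ Real.log ((m : ℝ) + 3) ^ 2 := by
  have h0 := one_le_log_age m
  calc ∑ a ∈ Finset.range m, highRate a
      ≤ ∑ a ∈ Finset.range m, Real.log ((m : ℝ) + 3) * lowRate a := by
        refine Finset.sum_le_sum fun a ha => ?_
        rw [highRate_eq]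
        refine mul_le_mul_of_nonneg_right (Real.log_le_log (by positivity) ?_) (lowRate_pos a).le
        have : (a : ℝ) ≤ m := by exact_mod_cast (Finset.mem_range.1 ha).le
        linarith
    _ ≤ Real.log ((m : ℝ) + 3) * Real.log ((m : ℝ) + 3) := by
        rw [← Finset.mul_sum]
        exact mul_le_mul_of_nonneg_left (sum_lowRate_le m) (by linarith)
    _ = _ := by ring

/-! ### Masses -/

/-- The total low rate of the nodes active in slot `t`. -/
def lowMass (rec : ℕ → SlotRecord) (t : ℕ) : ℝ :=
  ∑ i ∈ act rec t, lowRate (age i (hist rec t))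

open Classical in
/-- The total high rate of the active nodes that have not observed a success. -/
def freshMass (rec : ℕ → SlotRecord) (t : ℕ) : ℝ :=
  ∑ i ∈ (act rec t).filter (fun i => Fresh i (hist rec t)), highRate (age i (hist rec t))

/-- The contention in slot `t`. -/
def load (rec : ℕ → SlotRecord) (t : ℕ) : ℝ :=
  contention backoff (hist rec t) (rec t).arrivals

theorem lowMass_nonneg (rec : ℕ → SlotRecord) (t : ℕ) : 0 ≤ lowMass rec t :=
  Finset.sum_nonneg fun _ _ => (lowRate_pos _).le

theorem freshMass_nonneg (rec : ℕ → SlotRecord) (t : ℕ) : 0 ≤ freshMass rec t :=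
  Finset.sum_nonneg fun _ _ => (highRate_pos _).le

theorem load_eq (rec : ℕ → SlotRecord) (t : ℕ) :
    load rec t = ∑ i ∈ act rec t, (backoff (localView i (hist rec t)) : ℝ) := rfl

theorem lowMass_le_load (rec : ℕ → SlotRecord) (t : ℕ) : lowMass rec t ≤ load rec t := by
  rw [load_eq]
  refine Finset.sum_le_sum fun i _ => ?_
  rw [backoff_localView]
  split_ifs
  exacts [le_rfl, lowRate_le_highRate _]

theorem freshMass_le_load (rec : ℕ → SlotRecord) (t : ℕ) : freshMass rec t ≤ load rec t := by
  classical
  rw [load_eq, freshMass]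
  refine le_trans ?_ (Finset.sum_le_sum_of_subset_of_nonneg (Finset.filter_subset
    (fun i => Fresh i (hist rec t)) _) fun i _ _ => prob_nonneg backoff _)
  refine Finset.sum_le_sum fun i hi => ?_
  rw [backoff_localView, if_neg fun h => h.1 (Finset.mem_filter.1 hi).2]

/-- At even distance only fresh nodes use the high rate; this is what makes even slots uncrowded. -/
theorem load_le_of_even {rec : ℕ → SlotRecord} {t : ℕ} (he : Even (globalGap (hist rec t))) :
    load rec t ≤ freshMass rec t + lowMass rec t := by
  classical
  rw [load_eq, freshMass, Finset.sum_filter, lowMass, ← Finset.sum_add_distrib]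
  refine Finset.sum_le_sum fun i _ => ?_
  rw [backoff_localView]
  by_cases hf : Fresh i (hist rec t)
  · simpa [hf] using (lowRate_pos _).le
  · simp [hf, he]

/-- Whatever the parity, a node that is not fresh sends at most at the high rate, which is at most
`L` times its low rate. -/
theorem load_le {rec : ℕ → SlotRecord} {t : ℕ} {L : ℝ}
    (hL : ∀ i ∈ act rec t, Real.log ((age i (hist rec t) : ℝ) + 3) ≤ L) :
    load rec t ≤ freshMass rec t + L * lowMass rec t := by
  classical
  rw [load_eq, freshMass, Finset.sum_filter, lowMass, Finset.mul_sum, ← Finset.sum_add_distrib]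
  refine Finset.sum_le_sum fun i hi => ?_
  have h1 : (backoff (localView i (hist rec t)) : ℝ) ≤ highRate (age i (hist rec t)) :=
    backoffProb_le_highRate _
  have h2 : highRate (age i (hist rec t)) ≤ L * lowRate (age i (hist rec t)) := by
    rw [highRate_eq]
    exact mul_le_mul_of_nonneg_right (hL i hi) (lowRate_pos _).le
  split_ifs
  · have := (highRate_pos (age i (hist rec t))).le
    linarith
  · linarith

theorem mul_lowMass_le_succ {rec : ℕ → SlotRecord} {t : ℕ} (hs : (rec t).success = false) :
    3 / 4 * lowMass rec t ≤ lowMass rec (t + 1) := by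
  rw [lowMass, Finset.mul_sum]
  refine le_trans ?_ (Finset.sum_le_sum_of_subset_of_nonneg (s := act rec t)
    (fun i hi => mem_act_succ hi (by simp [hs])) fun i _ _ => (lowRate_pos _).le)
  refine Finset.sum_le_sum fun i hi => ?_
  rw [age_succ (lt_injected_of_mem_act hi)]
  exact lowRate_succ _

theorem globalGap_succ (rec : ℕ → SlotRecord) (t : ℕ) :
    globalGap (hist rec (t + 1)) =
      if (rec t).success then 0 else globalGap (hist rec t) + 1 := rfl

/-- Without a success fresh nodes stay active and fresh, and rates fall by at most a quarter. -/
theorem mul_freshMass_le_succ {rec : ℕ → SlotRecord} {t : ℕ} (hs : (rec t).success = false) :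
    3 / 4 * freshMass rec t ≤ freshMass rec (t + 1) := by
  classical
  rw [freshMass, freshMass, Finset.mul_sum]
  refine le_trans ?_ (Finset.sum_le_sum_of_subset_of_nonneg
    (s := (act rec t).filter (fun i => Fresh i (hist rec t)))
    (fun i hi => ?_) fun i _ _ => (highRate_pos _).le)
  · refine Finset.sum_le_sum fun i hi => ?_
    rw [age_succ (lt_injected_of_mem_act (Finset.mem_filter.1 hi).1)]
    exact highRate_succ _
  · rw [Finset.mem_filter] at hi ⊢
    refine ⟨mem_act_succ hi.1 (by simp [hs]), ?_⟩
    have h2 : age i (hist rec t) ≤ globalGap (hist rec t) := hi.2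
    unfold Fresh
    rw [age_succ (lt_injected_of_mem_act hi.1), globalGap_succ, hs]
    simpa using h2

theorem successes_eq_of_le_globalGap {rec : ℕ → SlotRecord} {t m : ℕ}
    (h : m ≤ globalGap (hist rec (t + m))) :
    successes (hist rec (t + m)) = successes (hist rec t) := by
  induction m with
  | zero => rfl
  | succ m ih =>
    rw [← add_assoc, globalGap_succ] at h
    have hs : (rec (t + m)).success = false := by
      by_contra hs
      rw [Bool.not_eq_false] at hs
      simp [hs] at h
    rw [hs] at h
    have h' : m ≤ globalGap (hist rec (t + m)) := by simpa using h
    rw [← add_assoc, hist, successes, ih h', hs]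
    simp

/-- A node that is still fresh has seen no success, so its fresh period lies inside one window. -/
theorem successes_eq_of_fresh {rec : ℕ → SlotRecord} {s t i : ℕ} (hs : i ∈ act rec s)
    (hst : s ≤ t) (hf : Fresh i (hist rec t)) :
    successes (hist rec t) = successes (hist rec s) := by
  obtain ⟨m, rfl⟩ := Nat.exists_eq_add_of_le hst
  apply successes_eq_of_le_globalGap
  have := age_add hs m
  unfold Fresh at hf
  omega

/-- The ages of a node at distinct slots are distinct, so the bound depends on the number of
selected slots and not on how long the node lives. -/
theorem sum_life_le {f : ℕ → ℝ} (hf : Antitone f) {rec : ℕ → SlotRecord} {H i : ℕ}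
    {A : Finset ℕ} (hA : A ⊆ life rec H i) :
    ∑ t ∈ A, f (age i (hist rec t)) ≤ ∑ a ∈ Finset.range A.card, f a := by
  classical
  obtain ⟨s, hs, hage⟩ := exists_life_eq rec H i
  have hinj : Set.InjOn (fun t => age i (hist rec t)) A := by
    intro x hx y hy hxy
    have hx' := hA hx
    have hy' := hA hy
    have h1 := hage x hx'
    have h2 := hage y hy'
    rw [hs, Finset.mem_Ico] at hx' hy'
    simp only at hxy
    omega
  rw [← Finset.card_image_of_injOn hinj, ← Finset.sum_image (f := f) hinj]
  exact sum_le_sum_range_of_antitone hf _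

theorem age_lt_card_life {rec : ℕ → SlotRecord} {H i t : ℕ} (ht : t ∈ life rec H i) :
    age i (hist rec t) < (life rec H i).card := by
  obtain ⟨s, hs, hage⟩ := exists_life_eq rec H i
  have h1 := hage t ht
  rw [hs, Finset.mem_Ico] at ht
  omega

theorem card_life_le (rec : ℕ → SlotRecord) (H i : ℕ) :
    (life rec H i).card ≤ activeSlots (hist rec H) := by
  rw [activeSlots_hist]
  refine Finset.card_le_card fun t ht => ?_
  rw [mem_life] at ht
  exact Finset.mem_filter.2 ⟨Finset.mem_range.2 ht.1, ⟨i, ht.2⟩⟩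

/-! ### Typical traces -/

/-- The logarithm of the number of active slots. -/
def logSlots (rec : ℕ → SlotRecord) (H : ℕ) : ℝ :=
  Real.log ((activeSlots (hist rec H) : ℝ) + 3)

/-- Traces in which the budgets are respected, and in which the sum of the success rates does not
deviate too much from the number of successes, neither globally nor between two successes. -/
structure Typical (rec : ℕ → SlotRecord) (H n d : ℕ) (B : ℝ) : Prop where
  valid : Valid (hist rec H)
  injected_le : injected (hist rec H) ≤ n
  jams_le : jams (hist rec H) ≤ d
  nonneg : 0 ≤ B
  sum_rate_le : ∑ t ∈ Finset.range H, successRate backoff (hist rec t) (rec t) ≤ 2 * (n + B)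
  sum_rate_window_le : ∀ w ≤ n,
    ∑ t ∈ (Finset.range H).filter (fun t => successes (hist rec t) = w),
      successRate backoff (hist rec t) (rec t) ≤ 2 * (B + 1)

theorem one_le_logSlots (rec : ℕ → SlotRecord) (H : ℕ) : 1 ≤ logSlots rec H :=
  one_le_log_age _

theorem log_age_le_logSlots {rec : ℕ → SlotRecord} {H i t : ℕ} (ht : t < H)
    (hi : i ∈ act rec t) : Real.log ((age i (hist rec t) : ℝ) + 3) ≤ logSlots rec H := by
  have h1 := (age_lt_card_life (mem_life.2 ⟨ht, hi⟩)).le.trans (card_life_le rec H i)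
  have : (age i (hist rec t) : ℝ) ≤ activeSlots (hist rec H) := by exact_mod_cast h1
  exact Real.log_le_log (by positivity) (by linarith)

variable {rec : ℕ → SlotRecord} {H n d : ℕ} {B : ℝ}

theorem Typical.lt_of_mem_act (hT : Typical rec H n d B) {t i : ℕ} (ht : t < H)
    (hi : i ∈ act rec t) : i < n :=
  (lt_injected_of_mem_act hi).trans_le
    ((injected_le_of_suffix (hist_suffix rec ht)).trans hT.injected_le)

theorem Typical.successes_le (hT : Typical rec H n d B) : successes (hist rec H) ≤ n := by
  have := successes_add_card_remaining hT.valid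
  have := hT.injected_le
  omega

theorem Typical.successes_le_of_lt (hT : Typical rec H n d B) {t : ℕ} (ht : t < H) :
    successes (hist rec t) ≤ n := by
  have h1 := successes_add_card_remaining (hT.valid.suffix (hist_suffix rec ht.le))
  have h2 := injected_le_of_suffix (hist_suffix rec ht.le)
  have := hT.injected_le
  omega

theorem card_mul_le_sum {A : Finset ℕ} {f : ℕ → ℝ} {c : ℝ} (h : ∀ t ∈ A, c ≤ f t) :
    (A.card : ℝ) * c ≤ ∑ t ∈ A, f t := by
  rw [← nsmul_eq_mul]
  exact Finset.card_nsmul_le_sum A f c h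

/-- Exchange the sums: each of the at most `n` nodes contributes a harmonic sum over its ages. -/
theorem sum_lowMass_le (hT : Typical rec H n d B) :
    ∑ t ∈ Finset.range H, lowMass rec t ≤ n * logSlots rec H := by
  have h1 : ∑ t ∈ Finset.range H, lowMass rec t =
      ∑ i ∈ Finset.range n, ∑ t ∈ life rec H i, lowRate (age i (hist rec t)) := by
    unfold lowMass
    apply Finset.sum_comm'
    intro t i
    rw [mem_life, Finset.mem_range, Finset.mem_range]
    constructor
    · rintro ⟨h, h'⟩
      exact ⟨⟨h, h'⟩, hT.lt_of_mem_act h h'⟩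
    · tauto
  rw [h1]
  refine (Finset.sum_le_card_nsmul _ _ (logSlots rec H) fun i _ => ?_).trans_eq (by simp)
  refine (sum_life_le antitone_lowRate subset_rfl).trans ((sum_lowRate_le _).trans ?_)
  have : ((life rec H i).card : ℝ) ≤ activeSlots (hist rec H) := by
    exact_mod_cast card_life_le rec H i
  exact Real.log_le_log (by positivity) (by linarith)

open Classical in
/-- The slots before `H` with property `P`. -/
def slots (H : ℕ) (P : ℕ → Prop) : Finset ℕ := (Finset.range H).filter P

theorem mem_slots {H : ℕ} {P : ℕ → Prop} {t : ℕ} : t ∈ slots H P ↔ t < H ∧ P t := by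
  simp [slots]

theorem card_lowMass_ge_one_le (hT : Typical rec H n d B) :
    ((slots H fun t => 1 ≤ lowMass rec t).card : ℝ) ≤ n * logSlots rec H := by
  have h := card_mul_le_sum (A := slots H fun t => 1 ≤ lowMass rec t) (f := lowMass rec) (c := 1)
    fun t ht => (mem_slots.1 ht).2
  rw [mul_one] at h
  refine h.trans (le_trans ?_ (sum_lowMass_le hT))
  exact Finset.sum_le_sum_of_subset_of_nonneg (fun t ht => Finset.mem_range.2 (mem_slots.1 ht).1)
    fun t _ _ => lowMass_nonneg rec t

theorem card_jammed_le (hT : Typical rec H n d B) :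
    (slots H fun t => (rec t).jammed = true).card ≤ d := by
  have := hT.jams_le
  rw [jams_hist] at this
  convert this using 2
  ext t
  simp [mem_slots]

theorem card_success_le (hT : Typical rec H n d B) :
    (slots H fun t => (rec t).success = true).card ≤ n := by
  have := hT.successes_le
  rw [successes_hist] at this
  convert this using 2
  ext t
  simp [mem_slots]

/-- The rate `x * exp (-2x)` is not monotone, so the two factors are bounded separately. -/
theorem successRate_ge {t : ℕ} {lo hi : ℝ} (hj : (rec t).jammed = false) (h0 : 0 ≤ lo)
    (h1 : lo ≤ load rec t) (h2 : load rec t ≤ hi) :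
    lo * Real.exp (-(2 * hi)) ≤ successRate backoff (hist rec t) (rec t) := by
  have h3 : successRate backoff (hist rec t) (rec t) =
      load rec t * Real.exp (-(2 * load rec t)) := by
    simp [successRate, hj, load]
  rw [h3]
  refine mul_le_mul h1 ?_ (Real.exp_pos _).le (h0.trans h1)
  rw [Real.exp_le_exp]
  linarith

/-! ### Slots with many fresh nodes -/

/-- The nodes that arrive between success number `w` and the next one. -/
def freshNodes (rec : ℕ → SlotRecord) (H n w : ℕ) : Finset ℕ :=
  open Classical in (Finset.range n).filter fun i =>
    ∃ t < H, successes (hist rec t) = w ∧ i ∈ act rec t ∧ Fresh i (hist rec t)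

theorem sum_card_freshNodes_le (rec : ℕ → SlotRecord) (H n m : ℕ) :
    ∑ w ∈ Finset.range m, (freshNodes rec H n w).card ≤ n := by
  classical
  rw [← Finset.card_biUnion]
  · calc _ ≤ (Finset.range n).card := Finset.card_le_card (by
          intro i hi
          rw [Finset.mem_biUnion] at hi
          obtain ⟨w, _, hi⟩ := hi
          exact (Finset.mem_filter.1 hi).1)
      _ = n := Finset.card_range n
  · intro w _ w' _ hne
    rw [Function.onFun, Finset.disjoint_left]
    intro i hi hi'
    obtain ⟨_, t, _, hw, ha, hf⟩ := Finset.mem_filter.1 hi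
    obtain ⟨_, t', _, hw', ha', hf'⟩ := Finset.mem_filter.1 hi'
    apply hne
    rw [← hw, ← hw']
    rcases le_total t t' with h | h
    · exact (successes_eq_of_fresh ha h hf').symm
    · exact successes_eq_of_fresh ha' h hf

/-- Only nodes fresh in window `w` contribute. The logarithm involves `A.card`, not the length of
the run; `window_count` relies on this self-bounding form. -/
theorem sum_freshMass_le (hT : Typical rec H n d B) {w : ℕ} {A : Finset ℕ}
    (hA : ∀ t ∈ A, t < H ∧ successes (hist rec t) = w) :
    ∑ t ∈ A, freshMass rec t ≤
      (freshNodes rec H n w).card * Real.log ((A.card : ℝ) + 3) ^ 2 := by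
  classical
  have h1 : ∑ t ∈ A, freshMass rec t = ∑ i ∈ freshNodes rec H n w,
      ∑ t ∈ A.filter (fun t => i ∈ act rec t ∧ Fresh i (hist rec t)),
        highRate (age i (hist rec t)) := by
    unfold freshMass
    apply Finset.sum_comm'
    intro t i
    simp only [Finset.mem_filter, freshNodes, Finset.mem_range]
    constructor
    · rintro ⟨h, h', h''⟩
      exact ⟨⟨h, h', h''⟩, hT.lt_of_mem_act (hA t h).1 h', t, (hA t h).1, (hA t h).2, h', h''⟩
    · tauto
  rw [h1]
  refine (Finset.sum_le_card_nsmul _ _ (Real.log ((A.card : ℝ) + 3) ^ 2) fun i _ => ?_).trans_eq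
    (by rw [nsmul_eq_mul])
  refine (sum_life_le antitone_highRate (H := H) fun t ht => ?_).trans ((sum_highRate_le _).trans ?_)
  · have := Finset.mem_filter.1 ht
    exact mem_life.2 ⟨(hA t this.1).1, this.2.1⟩
  · have h2 : ((A.filter fun t => i ∈ act rec t ∧ Fresh i (hist rec t)).card : ℝ) ≤ A.card := by
      exact_mod_cast Finset.card_filter_le _ _
    have h3 := one_le_log_age (A.filter fun t => i ∈ act rec t ∧ Fresh i (hist rec t)).card
    have h4 : Real.log (((A.filter fun t => i ∈ act rec t ∧ Fresh i (hist rec t)).card : ℝ) + 3) ≤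
        Real.log ((A.card : ℝ) + 3) := Real.log_le_log (by positivity) (by linarith)
    gcongr

theorem exp_two_lt : Real.exp 2 < 7.4 := by
  have h := Real.exp_one_lt_d9
  have : Real.exp 2 = Real.exp 1 * Real.exp 1 := by rw [← Real.exp_add]; norm_num
  rw [this]
  nlinarith [Real.exp_pos 1]

theorem exp_three_lt : Real.exp 3 < 21 := by
  have h := Real.exp_one_lt_d9
  have : Real.exp 3 = Real.exp 2 * Real.exp 1 := by rw [← Real.exp_add]; norm_num
  rw [this]
  nlinarith [Real.exp_pos 1, exp_two_lt]

/-- Here `b` counts the even slots of a window with fresh mass at least `1/2`; `j` of them are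
jammed or have large low mass, `a` have fresh mass above `log (b + 3) / 8`, `q` are the others, and
`k` nodes are fresh in the window. The `q` slots have success rate at least of order `(b +
3)^(-1/4)`, and a window sees few expected successes; so if they dominate, `b^(3/4)` is `O(B + 1)`.
Then `log² (b + 3)` is also `O(B + 1)`, and `htot` yields a bound proportional to `k`, which can be
summed over windows. -/
theorem window_count {b j a q k L : ℝ} (hb : 0 ≤ b) (hB : 0 ≤ B) (hj : 0 ≤ j) (hk : 0 ≤ k)
    (hL : Real.log (b + 3) ≤ L) (hsplit : b ≤ j + a + q)
    (ha : a * (Real.log (b + 3) / 8) ≤ k * Real.log (b + 3) ^ 2)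
    (hq : q * (1 / 2 * Real.exp (-(2 * (Real.log (b + 3) / 8 + 1)))) ≤ 2 * (B + 1))
    (htot : b * (1 / 2) ≤ k * Real.log (b + 3) ^ 2) :
    b ≤ 2 * j + 16 * k * L + 2000 * k * (B + 1) := by
  set y := Real.log (b + 3) with hy
  have hy0 : 1 ≤ y := by
    rw [hy, Real.le_log_iff_exp_le (by positivity)]
    linarith [Real.exp_one_lt_d9]
  have hL0 : 0 ≤ k * L := mul_nonneg hk (by linarith)
  have hkB : 0 ≤ k * (B + 1) := mul_nonneg hk (by linarith)
  have hey : Real.exp y = b + 3 := Real.exp_log (by positivity)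
  have ha' : a ≤ 8 * k * y := by
    by_contra hn
    push Not at hn
    nlinarith
  -- Otherwise `j + a` makes up at least half of `b`, and the bound on `a` finishes.
  by_cases hc : b ≤ 2 * q
  swap
  · have : k * y ≤ k * L := mul_le_mul_of_nonneg_left hL hk
    linarith
  -- For `1 ≤ b` the shift is absorbed by `b + 3 ≤ 4 * b`; for smaller `b` the logarithm is at most
  -- 2 and `htot` suffices.
  by_cases hb1 : b < 1
  · by_cases hq0 : q ≤ 0
    · have : b ≤ 0 := by linarith
      linarith
    · have hk' : b ≤ 2 * k * y ^ 2 := by linarith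
      have hy2 : y ≤ 2 := by
        rw [hy, Real.log_le_iff_le_exp (by positivity)]
        have := Real.exp_one_gt_d9
        have : Real.exp 2 = Real.exp 1 * Real.exp 1 := by rw [← Real.exp_add]; norm_num
        nlinarith
      have hkB' : k ≤ k * (B + 1) := le_mul_of_one_le_right hk (by linarith)
      have : k * y ^ 2 ≤ k * 4 := mul_le_mul_of_nonneg_left (by nlinarith) hk
      linarith
  push Not at hb1
  have hq' : q ≤ 4 * (B + 1) * (Real.exp 2 * Real.exp (y / 4)) := by
    have e : Real.exp (-(2 * (y / 8 + 1))) * (Real.exp 2 * Real.exp (y / 4)) = 1 := by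
      rw [← Real.exp_add, ← Real.exp_add, Real.exp_eq_one_iff]
      ring
    have := mul_le_mul_of_nonneg_right hq
      (show 0 ≤ 2 * (Real.exp 2 * Real.exp (y / 4)) by positivity)
    calc q = q * (1 / 2 * Real.exp (-(2 * (y / 8 + 1)))) * (2 * (Real.exp 2 * Real.exp (y / 4))) := by
          rw [show q * (1 / 2 * Real.exp (-(2 * (y / 8 + 1)))) *
            (2 * (Real.exp 2 * Real.exp (y / 4))) =
            q * (Real.exp (-(2 * (y / 8 + 1))) * (Real.exp 2 * Real.exp (y / 4))) by ring, e, mul_one]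
      _ ≤ _ := this
      _ = _ := by ring
  have h34 : Real.exp (3 * y / 4) ≤ 32 * Real.exp 2 * (B + 1) := by
    have e : Real.exp y = Real.exp (3 * y / 4) * Real.exp (y / 4) := by
      rw [← Real.exp_add]
      congr 1
      ring
    have h1 : Real.exp (3 * y / 4) * Real.exp (y / 4) ≤
        32 * Real.exp 2 * (B + 1) * Real.exp (y / 4) := by
      rw [← e, hey]
      linarith
    exact le_of_mul_le_mul_right h1 (Real.exp_pos _)
  -- From `exp x ≥ x² / 2` at `x = 3y/4`.
  have hy2 : y ^ 2 ≤ 32 / 9 * Real.exp (3 * y / 4) := by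
    have := Real.quadratic_le_exp_of_nonneg (x := 3 * y / 4) (by linarith)
    nlinarith
  have h2 : y ^ 2 ≤ 1000 * (B + 1) := by
    have := exp_two_lt
    nlinarith
  have h3 : k * y ^ 2 ≤ k * (1000 * (B + 1)) := mul_le_mul_of_nonneg_left h2 hk
  linarith

/-- The slots at even distance from the last success in which the fresh mass is large. -/
def evenFresh (rec : ℕ → SlotRecord) (H : ℕ) : Finset ℕ :=
  slots H fun t => Even (globalGap (hist rec t)) ∧ 1 / 2 ≤ freshMass rec t

-- Applies `window_count` to one window. An even unjammed slot with low mass below 1 and fresh mass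
-- at most `M` has contention between `1/2` and `M + 1`.
open Classical in
theorem card_evenFresh_window_le (hT : Typical rec H n d B) {w : ℕ} (hw : w ≤ n) :
    (((evenFresh rec H).filter fun t => successes (hist rec t) = w).card : ℝ) ≤
      2 * (((slots H fun t => (rec t).jammed = true ∨ 1 ≤ lowMass rec t).filter
        fun t => successes (hist rec t) = w).card : ℝ) +
      16 * (freshNodes rec H n w).card * logSlots rec H +
      2000 * (freshNodes rec H n w).card * (B + 1) := by
  set S := (evenFresh rec H).filter fun t => successes (hist rec t) = w with hS
  have hmem : ∀ t ∈ S, t < H ∧ (Even (globalGap (hist rec t)) ∧ 1 / 2 ≤ freshMass rec t) ∧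
      successes (hist rec t) = w := by
    intro t ht
    rw [hS, Finset.mem_filter, evenFresh, mem_slots] at ht
    tauto
  -- The divisor 8 makes `exp (2M)` the fourth root of `S.card + 3`, safely sublinear in the count.
  set M := Real.log ((S.card : ℝ) + 3) / 8 with hM
  set J := (slots H fun t => (rec t).jammed = true ∨ 1 ≤ lowMass rec t).filter
    fun t => successes (hist rec t) = w with hJ
  set S1 := S.filter fun t => M < freshMass rec t with hS1
  set S2 := S.filter fun t => (rec t).jammed = false ∧ lowMass rec t < 1 ∧ freshMass rec t ≤ M
    with hS2
  have hsub : S ⊆ J ∪ S1 ∪ S2 := by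
    intro t ht
    obtain ⟨h1, _, h3⟩ := hmem t ht
    rw [Finset.mem_union, Finset.mem_union]
    by_cases hj : (rec t).jammed = true ∨ 1 ≤ lowMass rec t
    · exact Or.inl (Or.inl (Finset.mem_filter.2 ⟨mem_slots.2 ⟨h1, hj⟩, h3⟩))
    · push Not at hj
      by_cases hf : freshMass rec t ≤ M
      · exact Or.inr (Finset.mem_filter.2 ⟨ht, by simpa using hj.1, hj.2, hf⟩)
      · exact Or.inl (Or.inr (Finset.mem_filter.2 ⟨ht, not_le.1 hf⟩))
  have hcard : (S.card : ℝ) ≤ J.card + S1.card + S2.card := by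
    exact_mod_cast (Finset.card_le_card hsub).trans ((Finset.card_union_le _ _).trans
      (Nat.add_le_add_right (Finset.card_union_le _ _) _))
  have hfresh := sum_freshMass_le hT (A := S) (w := w) fun t ht => ⟨(hmem t ht).1, (hmem t ht).2.2⟩
  have hS1S : S1 ⊆ S := Finset.filter_subset _ _
  have hS2S : S2 ⊆ S := Finset.filter_subset _ _
  refine window_count (Nat.cast_nonneg _) hT.nonneg (Nat.cast_nonneg _) (Nat.cast_nonneg _) ?_
    hcard ?_ ?_ ?_
  · have : S.card ≤ activeSlots (hist rec H) := by
      rw [activeSlots_hist]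
      refine Finset.card_le_card fun t ht => ?_
      obtain ⟨h1, ⟨_, h2⟩, _⟩ := hmem t ht
      refine Finset.mem_filter.2 ⟨Finset.mem_range.2 h1, ?_⟩
      by_contra hn
      rw [Finset.not_nonempty_iff_eq_empty] at hn
      rw [freshMass, hn] at h2
      norm_num at h2
    have : (S.card : ℝ) ≤ activeSlots (hist rec H) := by exact_mod_cast this
    exact Real.log_le_log (by positivity) (by linarith)
  · refine (card_mul_le_sum fun t ht => ((Finset.mem_filter.1 ht).2).le).trans ?_
    exact (Finset.sum_le_sum_of_subset_of_nonneg hS1S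
      fun t _ _ => freshMass_nonneg rec t).trans hfresh
  · refine (card_mul_le_sum (f := fun t => successRate backoff (hist rec t) (rec t))
      fun t ht => ?_).trans (le_trans ?_ (hT.sum_rate_window_le w hw))
    · obtain ⟨hts, hj, hl, hf⟩ := Finset.mem_filter.1 ht
      obtain ⟨_, ⟨he, h2⟩, _⟩ := hmem t hts
      refine successRate_ge hj (by norm_num) (h2.trans (freshMass_le_load rec t)) ?_
      have := load_le_of_even he
      linarith
    · refine Finset.sum_le_sum_of_subset_of_nonneg (fun t ht => ?_)
        fun t _ _ => successRate_nonneg _ _ _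
      have := hmem t (hS2S ht)
      exact Finset.mem_filter.2 ⟨Finset.mem_range.2 this.1, this.2.2⟩
  · exact (card_mul_le_sum fun t ht => (hmem t ht).2.1.2).trans hfresh

/-- Sum over windows: the fresh node counts add up to at most `n`, and the jammed or low-mass slots
are counted once. -/
theorem card_evenFresh_le (hT : Typical rec H n d B) :
    ((evenFresh rec H).card : ℝ) ≤
      2 * d + 18 * n * logSlots rec H + 2000 * n * (B + 1) := by
  classical
  set J := slots H fun t => (rec t).jammed = true ∨ 1 ≤ lowMass rec t with hJ
  have hJcard : (J.card : ℝ) ≤ d + n * logSlots rec H := by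
    have h1 : J ⊆ (slots H fun t => (rec t).jammed = true) ∪ slots H fun t => 1 ≤ lowMass rec t := by
      intro t ht
      rw [Finset.mem_union, mem_slots, mem_slots]
      have := mem_slots.1 ht
      tauto
    have h2 : (J.card : ℝ) ≤ (slots H fun t => (rec t).jammed = true).card +
        (slots H fun t => 1 ≤ lowMass rec t).card := by
      exact_mod_cast (Finset.card_le_card h1).trans (Finset.card_union_le _ _)
    have h3 : ((slots H fun t => (rec t).jammed = true).card : ℝ) ≤ d := by
      exact_mod_cast card_jammed_le hT
    linarith [card_lowMass_ge_one_le hT]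
  have hfib : ∀ S : Finset ℕ, (∀ t ∈ S, t < H) → S.card = ∑ w ∈ Finset.range (n + 1),
      (S.filter fun t => successes (hist rec t) = w).card := fun S hS =>
    Finset.card_eq_sum_card_fiberwise fun t ht =>
      Finset.mem_coe.2 (Finset.mem_range.2 (Nat.lt_succ_of_le (hT.successes_le_of_lt (hS t ht))))
  have h1 := hfib (evenFresh rec H) fun t ht => (mem_slots.1 ht).1
  have h2 := hfib J fun t ht => (mem_slots.1 ht).1
  have h3 : (∑ w ∈ Finset.range (n + 1), ((freshNodes rec H n w).card : ℝ)) ≤ n := by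
    exact_mod_cast sum_card_freshNodes_le rec H n (n + 1)
  have h4 : ((evenFresh rec H).card : ℝ) ≤ ∑ w ∈ Finset.range (n + 1),
      (2 * ((J.filter fun t => successes (hist rec t) = w).card : ℝ) +
      (freshNodes rec H n w).card * (16 * logSlots rec H + 2000 * (B + 1))) := by
    rw [h1]
    push_cast
    refine Finset.sum_le_sum fun w hw => ?_
    have := card_evenFresh_window_le hT (Nat.lt_succ_iff.1 (Finset.mem_range.1 hw))
    refine this.trans_eq ?_
    ring
  rw [Finset.sum_add_distrib, ← Finset.mul_sum, ← Finset.sum_mul] at h4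
  have h5 : (∑ w ∈ Finset.range (n + 1),
      ((J.filter fun t => successes (hist rec t) = w).card : ℝ)) = J.card := by
    exact_mod_cast h2.symm
  rw [h5] at h4
  have h6 := mul_le_mul_of_nonneg_right h3 (show 0 ≤ 16 * logSlots rec H + 2000 * (B + 1) by
    linarith [one_le_logSlots rec H, hT.nonneg])
  linarith

/-! ### Slots that do not serve a given node -/

/-- Contention lies between `1/(2L)` and `3/2`, so each slot has rate at least `e⁻³/(2L)`, against a
total of `2(n + B)`; the constant is `4e³ < 84`. -/
theorem card_moderate_le (hT : Typical rec H n d B) :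
    ((slots H fun t => (rec t).jammed = false ∧ Even (globalGap (hist rec t)) ∧
      1 / (2 * logSlots rec H) ≤ lowMass rec t ∧ lowMass rec t < 1 ∧
      freshMass rec t < 1 / 2).card : ℝ) ≤ 84 * logSlots rec H * (n + B) := by
  have hL := one_le_logSlots rec H
  have h := card_mul_le_sum (f := fun t => successRate backoff (hist rec t) (rec t))
    (c := 1 / (2 * logSlots rec H) * Real.exp (-(2 * (3 / 2))))
    (A := slots H fun t => (rec t).jammed = false ∧ Even (globalGap (hist rec t)) ∧
      1 / (2 * logSlots rec H) ≤ lowMass rec t ∧ lowMass rec t < 1 ∧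
      freshMass rec t < 1 / 2) fun t ht => by
    obtain ⟨_, hj, he, h1, h2, h3⟩ := mem_slots.1 ht
    refine successRate_ge hj (by positivity) (h1.trans (lowMass_le_load rec t)) ?_
    have := load_le_of_even he
    linarith
  have h' := h.trans ((Finset.sum_le_sum_of_subset_of_nonneg
    (fun t ht => Finset.mem_range.2 (mem_slots.1 ht).1)
    fun t _ _ => successRate_nonneg _ _ _).trans hT.sum_rate_le)
  have e : (1 / (2 * logSlots rec H) * Real.exp (-(2 * (3 / 2)))) *
      (2 * logSlots rec H * Real.exp 3) = 1 := by
    rw [show (1 / (2 * logSlots rec H) * Real.exp (-(2 * (3 / 2)))) *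
      (2 * logSlots rec H * Real.exp 3) = (1 / (2 * logSlots rec H) * (2 * logSlots rec H)) *
      (Real.exp (-(2 * (3 / 2))) * Real.exp 3) by ring, ← Real.exp_add,
      one_div_mul_cancel (by positivity)]
    norm_num
  have h2 := mul_le_mul_of_nonneg_right h'
    (show 0 ≤ 2 * logSlots rec H * Real.exp 3 by positivity)
  rw [mul_assoc, e, mul_one] at h2
  refine h2.trans ?_
  have h3 : 0 ≤ logSlots rec H * (n + B) :=
    mul_nonneg (by linarith) (add_nonneg (Nat.cast_nonneg _) hT.nonneg)
  nlinarith [exp_three_lt]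

/-- The slots at odd distance from the last success with high contention. -/
def oddLoaded (rec : ℕ → SlotRecord) (H : ℕ) : Finset ℕ :=
  slots H fun t => ¬ Even (globalGap (hist rec t)) ∧ 2 < load rec t

/-- Charge each crowded odd slot without success to its successor, an even slot that is jammed, or
has low mass at least 1, or fresh mass at least `1/2`, or moderate low mass. -/
theorem card_oddLoaded_le (hT : Typical rec H n d B) :
    ((oddLoaded rec H).card : ℝ) ≤
      3 * d + n + 1 + 19 * n * logSlots rec H + 2000 * n * (B + 1) +
        84 * logSlots rec H * (n + B) := by
  classical
  have hL := one_le_logSlots rec H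
  set S := slots H fun t => (rec t).success = true with hS
  set J := slots H fun t => (rec t).jammed = true with hJ
  set X := slots H fun t => 1 ≤ lowMass rec t with hX
  set Q := slots H fun t => (rec t).jammed = false ∧ Even (globalGap (hist rec t)) ∧
      1 / (2 * logSlots rec H) ≤ lowMass rec t ∧ lowMass rec t < 1 ∧ freshMass rec t < 1 / 2 with hQ
  set U := {H} ∪ J ∪ X ∪ Q ∪ evenFresh rec H with hU
  have hsub : oddLoaded rec H ⊆ S ∪ (oddLoaded rec H \ S) := by
    intro t ht
    rw [Finset.mem_union, Finset.mem_sdiff]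
    tauto
  -- The shift by one slot is the charging map; `{H}` in `U` receives the last slot of the trace.
  have hinj : (oddLoaded rec H \ S).card ≤ U.card := by
    refine Finset.card_le_card_of_injOn (fun t => t + 1) ?_ (fun x _ y _ h => by simpa using h)
    intro t ht
    rw [Finset.mem_coe, Finset.mem_sdiff, oddLoaded, mem_slots, hS, mem_slots] at ht
    obtain ⟨⟨htH, hodd, hload⟩, hns⟩ := ht
    have hs : (rec t).success = false := by
      rw [← Bool.not_eq_true]
      tauto
    rw [Finset.mem_coe, hU]
    simp only [Finset.mem_union, Finset.mem_singleton, hJ, hX, hQ, evenFresh, mem_slots]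
    by_cases htH' : t + 1 = H
    · tauto
    have hlt : t + 1 < H := by omega
    have heven : Even (globalGap (hist rec (t + 1))) := by
      rw [globalGap_succ, hs]
      simpa [Nat.even_add_one] using hodd
    by_cases hj : (rec (t + 1)).jammed = true
    · tauto
    by_cases hx : 1 ≤ lowMass rec (t + 1)
    · tauto
    by_cases hf : 1 / 2 ≤ freshMass rec (t + 1)
    · tauto
    have hq : 1 / (2 * logSlots rec H) ≤ lowMass rec (t + 1) := by
      have h1 := load_le (rec := rec) (L := logSlots rec H) fun i hi => log_age_le_logSlots htH hi
      have h2 := mul_freshMass_le_succ hs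
      have h3 := mul_lowMass_le_succ hs
      push Not at hf
      -- Fresh mass below `1/2` at `t + 1` was below `2/3` at `t`, so the low part carries the rest
      -- of the contention 2.
      have h4 : 1 ≤ logSlots rec H * lowMass rec t := by linarith
      rw [div_le_iff₀ (by positivity)]
      nlinarith [mul_le_mul_of_nonneg_left h3 (zero_le_one.trans hL)]
    rw [Bool.not_eq_true] at hj
    push Not at hx hf
    tauto
  have hUcard : (U.card : ℝ) ≤ 1 + J.card + X.card + Q.card + (evenFresh rec H).card := by
    have : U.card ≤ 1 + J.card + X.card + Q.card + (evenFresh rec H).card := by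
      rw [hU]
      refine (Finset.card_union_le _ _).trans (Nat.add_le_add_right ?_ _)
      refine (Finset.card_union_le _ _).trans (Nat.add_le_add_right ?_ _)
      refine (Finset.card_union_le _ _).trans (Nat.add_le_add_right ?_ _)
      exact (Finset.card_union_le _ _).trans (by simp)
    exact_mod_cast this
  have hcard : ((oddLoaded rec H).card : ℝ) ≤ S.card + U.card := by
    exact_mod_cast (Finset.card_le_card hsub).trans ((Finset.card_union_le _ _).trans
      (Nat.add_le_add_left hinj _))
  have h1 : (S.card : ℝ) ≤ n := by exact_mod_cast card_success_le hT
  have h2 : (J.card : ℝ) ≤ d := by exact_mod_cast card_jammed_le hT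
  have h3 := card_lowMass_ge_one_le hT
  have h4 := card_moderate_le hT
  have h5 := card_evenFresh_le hT
  linarith

/-- The slots that are jammed, contain a success, or have high contention at an odd distance from
the last success. -/
def badSlots (rec : ℕ → SlotRecord) (H : ℕ) : Finset ℕ :=
  slots H fun t => (rec t).jammed = true ∨ (rec t).success = true ∨
    ¬ Even (globalGap (hist rec t)) ∧ 2 < load rec t

theorem card_badSlots_le (hT : Typical rec H n d B) :
    ((badSlots rec H).card : ℝ) ≤
      4 * d + 2 * n + 1 + 19 * n * logSlots rec H + 2000 * n * (B + 1) +
        84 * logSlots rec H * (n + B) := by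
  classical
  have hsub : badSlots rec H ⊆ (slots H fun t => (rec t).jammed = true) ∪
      (slots H fun t => (rec t).success = true) ∪ oddLoaded rec H := by
    intro t ht
    have := mem_slots.1 ht
    simp only [Finset.mem_union, oddLoaded, mem_slots]
    tauto
  have h0 : ((badSlots rec H).card : ℝ) ≤ (slots H fun t => (rec t).jammed = true).card +
      (slots H fun t => (rec t).success = true).card + (oddLoaded rec H).card := by
    exact_mod_cast (Finset.card_le_card hsub).trans ((Finset.card_union_le _ _).trans
      (Nat.add_le_add_right (Finset.card_union_le _ _) _))
  have h1 : ((slots H fun t => (rec t).success = true).card : ℝ) ≤ n := by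
    exact_mod_cast card_success_le hT
  have h2 : ((slots H fun t => (rec t).jammed = true).card : ℝ) ≤ d := by
    exact_mod_cast card_jammed_le hT
  linarith [card_oddLoaded_le hT]

/-! ### Lifetimes -/

/-- Summation by parts: nonnegative partial sums stay nonnegative under decreasing weights. -/
theorem sum_mul_nonneg_of_antitone {f u : ℕ → ℝ} (hf : Antitone f) {m : ℕ}
    (hf0 : ∀ a, 0 ≤ f a) (hu : ∀ x ≤ m, 0 ≤ ∑ a ∈ Finset.range x, u a) :
    0 ≤ ∑ a ∈ Finset.range m, u a * f a := by
  have key : ∀ x ≤ m, f x * ∑ a ∈ Finset.range x, u a ≤ ∑ a ∈ Finset.range x, u a * f a := by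
    intro x
    induction x with
    | zero => simp
    | succ x ih =>
      intro hx
      calc f (x + 1) * ∑ a ∈ Finset.range (x + 1), u a
          ≤ f x * ∑ a ∈ Finset.range (x + 1), u a :=
            mul_le_mul_of_nonneg_right (hf (Nat.le_succ x)) (hu _ hx)
        _ = f x * ∑ a ∈ Finset.range x, u a + u x * f x := by
            rw [Finset.sum_range_succ]
            ring
        _ ≤ _ := by
            rw [Finset.sum_range_succ]
            linarith [ih (by omega)]
  exact (mul_nonneg (hf0 m) (hu m le_rfl)).trans (key m le_rfl)

/-- Bound the logarithm in the high rate below by its value at `x` and telescope the remaining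
harmonic sum. -/
theorem log_mul_le_sum_highRate {x m : ℕ} (h : x ≤ m) :
    Real.log ((x : ℝ) + 3) * (Real.log ((m : ℝ) + 3) - Real.log ((x : ℝ) + 3)) ≤
      ∑ a ∈ Finset.range m, if x ≤ a then highRate a else 0 := by
  induction m, h using Nat.le_induction with
  | base =>
    rw [sub_self, mul_zero]
    refine Finset.sum_nonneg fun a _ => ?_
    split_ifs
    exacts [(highRate_pos a).le, le_rfl]
  | succ m hm ih =>
    rw [Finset.sum_range_succ, if_pos hm, highRate_eq]
    have h0 := one_le_log_age x
    have h1 := log_sub_le_lowRate m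
    have h2 : Real.log ((x : ℝ) + 3) ≤ Real.log ((m : ℝ) + 3) := by
      have : (x : ℝ) ≤ m := by exact_mod_cast hm
      exact Real.log_le_log (by positivity) (by linarith)
    have h3 : Real.log ((x : ℝ) + 3) *
        (Real.log (((m + 1 : ℕ) : ℝ) + 3) - Real.log ((m : ℝ) + 3)) ≤
        Real.log ((m : ℝ) + 3) * lowRate m := by
      refine (mul_le_mul_of_nonneg_left h1 (by linarith)).trans ?_
      exact mul_le_mul_of_nonneg_right h2 (lowRate_pos m).le
    linarith

/-- In an odd slot that is not bad the node sends at the high rate, unjammed and with contention at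
most 2; over its lifetime it succeeds at most once, hence the `- 1`. -/
theorem nodeDeficit_ge (rec : ℕ → SlotRecord) (H i : ℕ) :
    Real.exp (-4) / 2 * ∑ t ∈ (life rec H i).filter
        (fun t => ¬ Even (globalGap (hist rec t)) ∧ t ∉ badSlots rec H),
      highRate (age i (hist rec t)) - 1 ≤ nodeDeficit backoff i (hist rec H) := by
  rw [nodeDeficit, total_hist]
  have e : ∀ t, (if i ∈ activeNodes (hist rec t) (rec t).arrivals then
      (if (rec t).jammed = false ∧ contention backoff (hist rec t) (rec t).arrivals ≤ 2 then
        Real.exp (-4) * (backoff (localView i (hist rec t)) : ℝ) / 2 else 0) -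
      (if (rec t).success = true ∧ i ∈ (rec t).senders then (1 : ℝ) else 0) else 0) =
      if i ∈ act rec t then
      (if (rec t).jammed = false ∧ load rec t ≤ 2 then
        Real.exp (-4) * (backoff (localView i (hist rec t)) : ℝ) / 2 else 0) -
      (if (rec t).success = true ∧ i ∈ (rec t).senders then (1 : ℝ) else 0) else 0 := fun t => rfl
  simp only [e]
  rw [← Finset.sum_filter]
  change _ ≤ ∑ t ∈ life rec H i, _
  rw [Finset.sum_sub_distrib]
  refine sub_le_sub ?_ (sum_success_le_one rec H i)
  rw [Finset.mul_sum, Finset.sum_filter]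
  refine Finset.sum_le_sum fun t ht => ?_
  by_cases h : ¬ Even (globalGap (hist rec t)) ∧ t ∉ badSlots rec H
  · have h1 : ¬ ((rec t).jammed = true ∨ (rec t).success = true ∨
        ¬ Even (globalGap (hist rec t)) ∧ 2 < load rec t) := fun hb =>
      h.2 (mem_slots.2 ⟨(mem_life.1 ht).1, hb⟩)
    push Not at h1
    have h2 : (rec t).jammed = false ∧ load rec t ≤ 2 :=
      ⟨by simpa using h1.1, h1.2.2 h.1⟩
    rw [if_pos h, if_pos h2, backoff_localView, if_neg fun h3 => h.1 h3.2]
    exact le_of_eq (by ring)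
  · rw [if_neg h]
    split_ifs
    · have := prob_nonneg backoff (localView i (hist rec t))
      positivity
    · exact le_rfl

/-- The number of good slots among the first `x` slots of a node. -/
theorem count_good_ge {s l : ℕ} {i : ℕ} (hlife : life rec H i = Finset.Ico s (s + l))
    {x : ℕ} (hx : x ≤ l) :
    ((x : ℝ) - 1 - 3 * ((badSlots rec H) ∩ life rec H i).card) / 2 ≤
      ∑ a ∈ Finset.range x,
        if ¬ Even (globalGap (hist rec (s + a))) ∧ s + a ∉ badSlots rec H then (1 : ℝ) else 0 := by
  set b : ℝ := (((badSlots rec H) ∩ life rec H i).card : ℝ) with hb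
  set od : ℕ → ℝ := fun a => if ¬ Even (globalGap (hist rec (s + a))) then 1 else 0 with hod
  set ev : ℕ → ℝ := fun a => if Even (globalGap (hist rec (s + a))) then 1 else 0 with hev
  set bd : ℕ → ℝ := fun a => if s + a ∈ badSlots rec H then 1 else 0 with hbd
  have hbd0 : ∀ a, 0 ≤ bd a := fun a => by simp only [hbd]; split_ifs <;> norm_num
  have hod0 : ∀ a, 0 ≤ od a := fun a => by simp only [hod]; split_ifs <;> norm_num
  have hxH : ∀ a < x, s + a < H := fun a ha =>
    (mem_life.1 (hlife ▸ Finset.mem_Ico.2 ⟨by omega, by omega⟩ : s + a ∈ life rec H i)).1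
  have hbsum : ∑ a ∈ Finset.range x, bd a ≤ b := by
    simp only [hbd]
    rw [← Finset.sum_filter, Finset.sum_const, nsmul_eq_mul, mul_one, hb]
    have : ((Finset.range x).filter fun a => s + a ∈ badSlots rec H).card ≤
        ((badSlots rec H) ∩ life rec H i).card := by
      refine Finset.card_le_card_of_injOn (fun a => s + a) (fun a ha => ?_)
        (fun a _ b _ h => by simpa using h)
      have ha' := Finset.mem_filter.1 (Finset.mem_coe.1 ha)
      have := Finset.mem_range.1 ha'.1
      rw [Finset.mem_coe, Finset.mem_inter, hlife, Finset.mem_Ico]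
      exact ⟨ha'.2, Nat.le_add_right _ _, Nat.add_lt_add_left (by omega) s⟩
    exact_mod_cast this
  have hsplit : ∑ a ∈ Finset.range x, od a + ∑ a ∈ Finset.range x, ev a = x := by
    rw [← Finset.sum_add_distrib, Finset.sum_congr rfl (g := fun _ => (1 : ℝ))]
    · simp
    · intro a _
      simp only [hod, hev]
      split_ifs <;> simp_all
  -- An even slot is preceded by an odd one or by a success, which is bad. The first slot has no
  -- predecessor in the lifetime, hence the `1` in `hev'`.
  have hpair : ∀ a, a + 1 < x → ev (a + 1) ≤ od a + bd a := by
    intro a ha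
    simp only [hev]
    split_ifs with h1
    swap
    · exact add_nonneg (hod0 a) (hbd0 a)
    · rw [← add_assoc, globalGap_succ] at h1
      by_cases hs : (rec (s + a)).success = true
      · have : bd a = 1 := if_pos (mem_slots.2 ⟨hxH a (by omega), Or.inr (Or.inl hs)⟩)
        linarith [hod0 a]
      · rw [if_neg hs, Nat.even_add_one] at h1
        have : od a = 1 := if_pos h1
        linarith [hbd0 a]
  have hev' : ∑ a ∈ Finset.range x, ev a ≤
      1 + ∑ a ∈ Finset.range x, od a + ∑ a ∈ Finset.range x, bd a := by
    have hev1 : ∀ a, ev a ≤ 1 := fun a => by simp only [hev]; split_ifs <;> norm_num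
    cases x with
    | zero => simp
    | succ y =>
      rw [Finset.sum_range_succ', Finset.sum_range_succ od, Finset.sum_range_succ bd]
      have := Finset.sum_le_sum fun a (ha : a ∈ Finset.range y) =>
        hpair a (by have := Finset.mem_range.1 ha; omega)
      rw [Finset.sum_add_distrib] at this
      linarith [hev1 0, hod0 y, hbd0 y]
  have hgood : ∑ a ∈ Finset.range x, od a - ∑ a ∈ Finset.range x, bd a ≤
      ∑ a ∈ Finset.range x,
        if ¬ Even (globalGap (hist rec (s + a))) ∧ s + a ∉ badSlots rec H then (1 : ℝ) else 0 := by
    rw [← Finset.sum_sub_distrib]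
    refine Finset.sum_le_sum fun a _ => ?_
    simp only [hod, hbd]
    split_ifs <;> simp_all
  linarith

/-- The worst placement of bad slots is at young ages, where the rate is largest. Write off the
first `x` ages; in every longer prefix the good slots outnumber half of the remainder, and summation
by parts compares the weighted sums. -/
theorem nodeDeficit_ge_log_mul_log {i x : ℕ} (hx : x ≤ (life rec H i).card)
    (hb : 3 * ((badSlots rec H) ∩ life rec H i).card + 1 ≤ x) :
    Real.exp (-4) / 4 * (Real.log ((x : ℝ) + 3) *
      (Real.log (((life rec H i).card : ℝ) + 3) - Real.log ((x : ℝ) + 3))) - 1 ≤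
      nodeDeficit backoff i (hist rec H) := by
  obtain ⟨s, hlife, hage⟩ := exists_life_eq rec H i
  set l := (life rec H i).card with hl
  have h1 : ∑ t ∈ (life rec H i).filter
        (fun t => ¬ Even (globalGap (hist rec t)) ∧ t ∉ badSlots rec H),
      highRate (age i (hist rec t)) = ∑ a ∈ Finset.range l,
        (if ¬ Even (globalGap (hist rec (s + a))) ∧ s + a ∉ badSlots rec H then (1 : ℝ) else 0) *
          highRate a := by
    rw [Finset.sum_filter]
    conv_lhs => rw [hlife]
    rw [Finset.sum_Ico_eq_sum_range, Nat.add_sub_cancel_left]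
    refine Finset.sum_congr rfl fun a ha => ?_
    have hmem : s + a ∈ life rec H i := by
      rw [hlife, Finset.mem_Ico]
      have := Finset.mem_range.1 ha
      omega
    rw [hage _ hmem, Nat.add_sub_cancel_left, ite_mul, one_mul, zero_mul]
  have h2 := sum_mul_nonneg_of_antitone (m := l) antitone_highRate (fun a => (highRate_pos a).le)
    (u := fun a => (if ¬ Even (globalGap (hist rec (s + a))) ∧ s + a ∉ badSlots rec H
      then (1 : ℝ) else 0) - if x ≤ a then 1 / 2 else 0) (by
    intro y hy
    rw [Finset.sum_sub_distrib, sub_nonneg]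
    by_cases hxy : x ≤ y
    · refine le_trans ?_ (count_good_ge hlife hy)
      have e : ∑ a ∈ Finset.range y, (if x ≤ a then (1 / 2 : ℝ) else 0) = ((y : ℝ) - x) / 2 := by
        rw [← Finset.sum_filter, Finset.sum_const, nsmul_eq_mul]
        have : (Finset.range y).filter (x ≤ ·) = Finset.Ico x y := by
          ext a
          simp
          tauto
        rw [this, Nat.card_Ico, Nat.cast_sub hxy]
        ring
      rw [e]
      have : (3 * ((badSlots rec H) ∩ life rec H i).card + 1 : ℝ) ≤ x := by exact_mod_cast hb
      linarith
    · rw [Finset.sum_eq_zero]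
      · exact Finset.sum_nonneg fun a _ => by split_ifs <;> norm_num
      · intro a ha
        have := Finset.mem_range.1 ha
        rw [if_neg (by omega)])
  simp only [sub_mul, Finset.sum_sub_distrib] at h2
  have h3 : ∑ a ∈ Finset.range l, (if x ≤ a then (1 / 2 : ℝ) else 0) * highRate a =
      1 / 2 * ∑ a ∈ Finset.range l, if x ≤ a then highRate a else 0 := by
    rw [Finset.mul_sum]
    refine Finset.sum_congr rfl fun a _ => ?_
    split_ifs <;> ring
  have h4 := log_mul_le_sum_highRate hx
  have h5 := nodeDeficit_ge rec H i
  rw [h1] at h5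
  refine le_trans ?_ h5
  rw [h3] at h2
  have h6 := mul_le_mul_of_nonneg_left (h4.trans (by linarith : _ ≤ 2 * ∑ a ∈ Finset.range l,
        (if ¬ Even (globalGap (hist rec (s + a))) ∧ s + a ∉ badSlots rec H then (1 : ℝ) else 0) *
          highRate a)) (show 0 ≤ Real.exp (-4) / 4 by positivity)
  linarith

/-- Cut at age `x = l / K`. Then `log x` is about at least `log l / 2` because `l ≥ 4K²`, while `log
(l / x)` is at least about `log (K / 2)`, so `K` tunes the coefficient of `log l`. -/
theorem nodeDeficit_ge_log {i K : ℕ} (hK : 4 ≤ K) (hl : 4 * K ^ 2 ≤ (life rec H i).card)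
    (hb : 6 * K * ((badSlots rec H) ∩ life rec H i).card < (life rec H i).card) :
    Real.exp (-4) / 8 * Real.log ((K : ℝ) / 2) * Real.log ((life rec H i).card) - 1 ≤
      nodeDeficit backoff i (hist rec H) := by
  set l := (life rec H i).card with hld
  set b := ((badSlots rec H) ∩ life rec H i).card
  set x := l / K with hx
  have hK0 : 0 < K := by omega
  have hxl : x ≤ l := Nat.div_le_self _ _
  have hbx : 3 * b + 1 ≤ x := by
    rw [hx, Nat.le_div_iff_mul_le hK0]
    nlinarith
  refine le_trans ?_ (nodeDeficit_ge_log_mul_log hxl hbx)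
  have hKr : (4 : ℝ) ≤ K := by exact_mod_cast hK
  have hlr : 4 * (K : ℝ) ^ 2 ≤ l := by exact_mod_cast hl
  have hl0 : (0 : ℝ) < l := by nlinarith
  have h1 : (x : ℝ) * K ≤ l := by exact_mod_cast Nat.div_mul_le_self l K
  have h2 : (l : ℝ) ≤ (x + 3) * K := by
    have : l < (x + 1) * K := Nat.lt_mul_of_div_lt (Nat.lt_succ_self _) hK0
    have : (l : ℝ) < (x + 1) * K := by exact_mod_cast this
    nlinarith
  have hA : 1 / 2 * Real.log l ≤ Real.log ((x : ℝ) + 3) := by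
    have : Real.log l ≤ Real.log (((x : ℝ) + 3) ^ 2) := by
      refine Real.log_le_log hl0 ?_
      have h3 : (l : ℝ) * (K : ℝ) ^ 2 ≤ ((x : ℝ) + 3) ^ 2 * (K : ℝ) ^ 2 := by
        rw [← mul_pow]
        nlinarith
      exact le_of_mul_le_mul_right h3 (by positivity)
    rw [Real.log_pow] at this
    push_cast at this
    linarith
  have hB : Real.log ((K : ℝ) / 2) ≤ Real.log ((l : ℝ) + 3) - Real.log ((x : ℝ) + 3) := by
    rw [← Real.log_div (by positivity) (by positivity)]
    refine Real.log_le_log (by positivity) ?_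
    rw [div_le_div_iff₀ two_pos (by positivity)]
    nlinarith
  have hK2 : 0 ≤ Real.log ((K : ℝ) / 2) := Real.log_nonneg (by linarith)
  have h5 : 1 / 2 * Real.log l * Real.log ((K : ℝ) / 2) ≤ Real.log ((x : ℝ) + 3) *
      (Real.log ((l : ℝ) + 3) - Real.log ((x : ℝ) + 3)) :=
    mul_le_mul hA hB hK2 (zero_le_one.trans (one_le_log_age x))
  have := mul_le_mul_of_nonneg_left h5 (show 0 ≤ Real.exp (-4) / 4 by positivity)
  linarith

/-! ### Covering the active slots by lifetimes. -/

/-- A finite family of intervals has a disjoint subfamily that covers a third of its union. -/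
theorem exists_disjoint_intervals (s l : ℕ → ℕ) (I : Finset ℕ) :
    ∃ J ⊆ I, (J : Set ℕ).PairwiseDisjoint (fun i => Finset.Ico (s i) (s i + l i)) ∧
      (I.biUnion fun i => Finset.Ico (s i) (s i + l i)).card ≤ ∑ j ∈ J, 3 * l j := by
  classical
  induction hc : I.card using Nat.strong_induction_on generalizing I with
  | _ m ih =>
  rcases I.eq_empty_or_nonempty with rfl | hne
  · exact ⟨∅, subset_rfl, by simp, by simp⟩
  obtain ⟨j, hj, hmax⟩ := I.exists_max_image l hne
  set U : ℕ → Finset ℕ := fun i => Finset.Ico (s i) (s i + l i) with hU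
  set I' := (I.erase j).filter fun i => Disjoint (U i) (U j) with hI'
  have hI'I : I' ⊆ I.erase j := Finset.filter_subset _ _
  obtain ⟨J', hJ', hdisj, hcard⟩ := ih I'.card (by
    rw [← hc]
    exact (Finset.card_le_card hI'I).trans_lt (Finset.card_erase_lt_of_mem hj)) I' rfl
  have hjJ' : j ∉ J' := fun h => (Finset.mem_erase.1 (hI'I (hJ' h))).1 rfl
  refine ⟨insert j J', ?_, ?_, ?_⟩
  · refine Finset.insert_subset hj fun i hi => ?_
    exact (Finset.mem_erase.1 (hI'I (hJ' hi))).2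
  · rw [Finset.coe_insert]
    refine hdisj.insert fun i hi _ => ?_
    exact ((Finset.mem_filter.1 (hJ' hi)).2).symm
  · rw [Finset.sum_insert hjJ']
    -- An interval meeting the longest one lies in its threefold enlargement; truncated subtraction
    -- at 0 only shortens this.
    have hsub : I.biUnion U ⊆ Finset.Ico (s j - l j) (s j + 2 * l j) ∪ I'.biUnion U := by
      intro t ht
      obtain ⟨i, hi, hti⟩ := Finset.mem_biUnion.1 ht
      have hti' := Finset.mem_Ico.1 hti
      rw [Finset.mem_union, Finset.mem_Ico]
      by_cases hij : i = j
      · subst hij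
        left
        omega
      by_cases hd : Disjoint (U i) (U j)
      · right
        exact Finset.mem_biUnion.2
          ⟨i, Finset.mem_filter.2 ⟨Finset.mem_erase.2 ⟨hij, hi⟩, hd⟩, hti⟩
      · left
        rw [Finset.not_disjoint_iff] at hd
        obtain ⟨x, hx, hx'⟩ := hd
        rw [Finset.mem_Ico] at hx hx'
        have := hmax i hi
        omega
    refine (Finset.card_le_card hsub).trans ((Finset.card_union_le _ _).trans ?_)
    refine add_le_add ?_ hcard
    rw [Nat.card_Ico]
    omega

/-- On a disjoint subfamily the sets `D ∩ life` are disjoint, so the density hypothesis sums to `M *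
D.card`; passing to that subfamily costs the factor 3. -/
theorem card_biUnion_life_le {M : ℕ} {I D : Finset ℕ}
    (h : ∀ i ∈ I, (life rec H i).card ≤ M * (D ∩ life rec H i).card) :
    (I.biUnion (life rec H)).card ≤ 3 * M * D.card := by
  classical
  choose s hs hage using exists_life_eq rec H
  obtain ⟨J, hJI, hdisj, hcard⟩ :=
    exists_disjoint_intervals s (fun i => (life rec H i).card) I
  have e : (fun i => Finset.Ico (s i) (s i + (life rec H i).card)) = life rec H :=
    funext fun i => (hs i).symm
  rw [e] at hdisj hcard
  refine hcard.trans ?_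
  calc ∑ j ∈ J, 3 * (life rec H j).card ≤ ∑ j ∈ J, 3 * M * (D ∩ life rec H j).card := by
        refine Finset.sum_le_sum fun j hj => ?_
        have := h j (hJI hj)
        nlinarith
    _ = 3 * M * (J.biUnion fun j => D ∩ life rec H j).card := by
        rw [← Finset.mul_sum, Finset.card_biUnion]
        intro i hi j hj hij
        exact (hdisj hi hj hij).mono Finset.inter_subset_right Finset.inter_subset_right
    _ ≤ 3 * M * D.card := by
        refine Nat.mul_le_mul_left _ (Finset.card_le_card fun t ht => ?_)
        obtain ⟨j, _, hj⟩ := Finset.mem_biUnion.1 ht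
        exact (Finset.mem_inter.1 hj).1

theorem half_le_log_one_add {x : ℝ} (h0 : 0 ≤ x) (h1 : x ≤ 1) : x / 2 ≤ Real.log (1 + x) := by
  rw [Real.le_log_iff_exp_le (by linarith)]
  have h := Real.exp_bound_div_one_sub_of_interval (x := x / 2) (by linarith) (by linarith)
  refine h.trans ?_
  rw [div_le_iff₀ (by linarith)]
  nlinarith

/-- The bound on the number of active slots of a typical trace in which the surpluses of the nodes
are typical as well. -/
theorem activeSlots_le (hT : Typical rec H n d B) {K : ℕ} (hK : 4 ≤ K) {c : ℝ} (hc : 2 ≤ c)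
    (hcK : c ≤ Real.exp (-4) / 8 * Real.log ((K : ℝ) / 2)) {N : ℕ}
    (hN : activeSlots (hist rec H) = N) (hN0 : 0 < N) (hnN : n ≤ N)
    (hcB : B + 2 ≤ (c / 2 - 1) * Real.log N)
    (hz : ∀ z : ℝ, z = 1 / N ∨ z = 1 / Real.sqrt N →
      ∑ i ∈ Finset.range n, Real.log (1 + z * Real.exp (nodeDeficit backoff i (hist rec H))) ≤
        z * n + B) :
    (N : ℝ) ≤ 4 * K ^ 2 * n + 18 * K * (badSlots rec H).card + 2 * n + 2 * Real.sqrt N * B := by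
  classical
  set l : ℕ → ℕ := fun i => (life rec H i).card with hl
  set γ : ℕ → ℝ := fun i => nodeDeficit backoff i (hist rec H) with hγ
  have hNr : (0 : ℝ) < N := by exact_mod_cast hN0
  have hsq : 0 < Real.sqrt N := Real.sqrt_pos.2 hNr
  set I1 := (Finset.range n).filter fun i => l i < 4 * K ^ 2 with hI1
  set I2 := (Finset.range n).filter fun i =>
    l i ≤ 6 * K * ((badSlots rec H) ∩ life rec H i).card with hI2
  set I3 := (Finset.range n).filter fun i => 4 * K ^ 2 ≤ l i ∧
    6 * K * ((badSlots rec H) ∩ life rec H i).card < l i with hI3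
  have hcover : N ≤ (I1.biUnion (life rec H)).card + (I2.biUnion (life rec H)).card +
      (I3.biUnion (life rec H)).card := by
    rw [← hN, activeSlots_hist]
    refine (Finset.card_le_card (t := I1.biUnion (life rec H) ∪ I2.biUnion (life rec H) ∪
      I3.biUnion (life rec H)) fun t ht => ?_).trans ((Finset.card_union_le _ _).trans
      (Nat.add_le_add_right (Finset.card_union_le _ _) _))
    obtain ⟨htH, i, hi⟩ := Finset.mem_filter.1 ht
    have htH' := Finset.mem_range.1 htH
    have hin := Finset.mem_range.2 (hT.lt_of_mem_act htH' hi)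
    have hmem := mem_life.2 ⟨htH', hi⟩
    simp only [Finset.mem_union, Finset.mem_biUnion]
    by_cases h1 : l i < 4 * K ^ 2
    · exact Or.inl (Or.inl ⟨i, Finset.mem_filter.2 ⟨hin, h1⟩, hmem⟩)
    by_cases h2 : l i ≤ 6 * K * ((badSlots rec H) ∩ life rec H i).card
    · exact Or.inl (Or.inr ⟨i, Finset.mem_filter.2 ⟨hin, h2⟩, hmem⟩)
    · exact Or.inr ⟨i, Finset.mem_filter.2 ⟨hin, not_lt.1 h1, not_le.1 h2⟩, hmem⟩
  have hpot : ∀ z : ℝ, z = 1 / N ∨ z = 1 / Real.sqrt N → ∀ I ⊆ Finset.range n,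
      ∑ i ∈ I, Real.log (1 + z * Real.exp (γ i)) ≤ z * n + B := by
    intro z hz' I hI
    have hz0 : 0 < z := by
      rcases hz' with rfl | rfl <;> positivity
    refine le_trans (Finset.sum_le_sum_of_subset_of_nonneg hI fun i _ _ => ?_) (hz z hz')
    refine Real.log_nonneg ?_
    have : 0 < z * Real.exp (γ i) := by positivity
    linarith
  have hlog1 : ∀ i ∈ I3, 2 ≤ Real.log (l i) := by
    intro i hi
    have h1 : 4 * K ^ 2 ≤ l i := (Finset.mem_filter.1 hi).2.1
    have h2 : (64 : ℝ) ≤ l i := by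
      have : 64 ≤ l i := by nlinarith
      exact_mod_cast this
    rw [Real.le_log_iff_exp_le (by linarith)]
    linarith [exp_two_lt]
  have hγl : ∀ i ∈ I3, c * Real.log (l i) - 1 ≤ γ i := by
    intro i hi
    obtain ⟨_, h1, h2⟩ := Finset.mem_filter.1 hi
    refine le_trans ?_ (nodeDeficit_ge_log hK h1 h2)
    have := mul_le_mul_of_nonneg_right hcK (zero_le_two.trans (hlog1 i hi))
    exact sub_le_sub_right this 1
  -- The scale `z = 1 / N` isolates a single node: living beyond `√N` would make its own factor
  -- alone exceed the budget, by `hcB`.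
  have hshort : ∀ i ∈ I3, (l i : ℝ) ≤ Real.sqrt N := by
    intro i hi
    by_contra hn
    push Not at hn
    have h1 := hpot _ (Or.inl rfl) {i}
      (Finset.singleton_subset_iff.2 (Finset.filter_subset _ _ hi))
    rw [Finset.sum_singleton] at h1
    have h2 : (1 : ℝ) / N * n ≤ 1 := by
      rw [one_div_mul_eq_div, div_le_one hNr]
      exact_mod_cast hnN
    have h3 : γ i - Real.log N ≤ Real.log (1 + 1 / N * Real.exp (γ i)) := by
      have e : γ i - Real.log N = Real.log (1 / N * Real.exp (γ i)) := by
        rw [Real.log_mul (by positivity) (Real.exp_pos _).ne', Real.log_exp, one_div, Real.log_inv]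
        ring
      rw [e]
      exact Real.log_le_log (by positivity) (by linarith)
    have h4 : 1 / 2 * Real.log N < Real.log (l i) := by
      have := Real.log_lt_log hsq hn
      rw [Real.log_sqrt hNr.le] at this
      linarith
    have h5 := hγl i hi
    have h6 : c * (1 / 2 * Real.log N) < c * Real.log (l i) :=
      mul_lt_mul_of_pos_left h4 (by linarith)
    linarith
  -- With `z = 1 / √N` each `z * l i` is at most 1, where `log (1 + x)` is at least `x / 2`; the
  -- potential then bounds the sum of the lengths linearly.
  have hlong : (∑ i ∈ I3, (l i : ℝ)) ≤ 2 * n + 2 * Real.sqrt N * B := by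
    have h1 := hpot _ (Or.inr rfl) I3 (Finset.filter_subset _ _)
    have h2 : ∑ i ∈ I3, (l i : ℝ) * (1 / Real.sqrt N / 2) ≤ 1 / Real.sqrt N * n + B := by
      refine le_trans (Finset.sum_le_sum fun i hi => ?_) h1
      have hl0 : (0 : ℝ) < l i := by
        by_contra hn
        have : l i = 0 := by
          have := not_lt.1 hn
          exact_mod_cast le_antisymm this (Nat.cast_nonneg _)
        have h2 := hlog1 i hi
        rw [this] at h2
        norm_num at h2
      -- From `c ≥ 2` and `log (l i) ≥ 2`, which absorb the loss of 1.
      have hle : (l i : ℝ) ≤ Real.exp (γ i) := by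
        rw [← Real.log_le_iff_le_exp hl0]
        have := hγl i hi
        have := hlog1 i hi
        nlinarith
      have h3 : (l i : ℝ) * (1 / Real.sqrt N) ≤ 1 := by
        rw [mul_one_div, div_le_one hsq]
        exact hshort i hi
      have h4 := half_le_log_one_add (mul_nonneg hl0.le (by positivity)) h3
      rw [mul_div_assoc] at h4
      refine h4.trans (Real.log_le_log (by positivity) ?_)
      rw [mul_comm (l i : ℝ)]
      gcongr
    rw [← Finset.sum_mul] at h2
    have h3 := mul_le_mul_of_nonneg_right h2 (show 0 ≤ 2 * Real.sqrt N by positivity)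
    have e : (1 / Real.sqrt N / 2) * (2 * Real.sqrt N) = 1 := by field_simp
    have e' : (1 / Real.sqrt N * n + B) * (2 * Real.sqrt N) = 2 * n + 2 * Real.sqrt N * B := by
      field_simp
    rwa [mul_assoc, e, mul_one, e'] at h3
  have h1 : ((I1.biUnion (life rec H)).card : ℝ) ≤ 4 * K ^ 2 * n := by
    have : (I1.biUnion (life rec H)).card ≤ n * (4 * K ^ 2) := by
      refine (Finset.card_biUnion_le_card_mul _ _ (4 * K ^ 2)
        fun i hi => (Finset.mem_filter.1 hi).2.le).trans ?_
      exact Nat.mul_le_mul_right _ (by simpa using Finset.card_filter_le (Finset.range n) _)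
    have : ((I1.biUnion (life rec H)).card : ℝ) ≤ n * (4 * K ^ 2) := by exact_mod_cast this
    linarith
  have h2 : ((I2.biUnion (life rec H)).card : ℝ) ≤ 18 * K * (badSlots rec H).card := by
    have := card_biUnion_life_le (rec := rec) (H := H) (M := 6 * K) (I := I2) (D := badSlots rec H)
      fun i hi => (Finset.mem_filter.1 hi).2
    have : ((I2.biUnion (life rec H)).card : ℝ) ≤ 3 * (6 * K) * (badSlots rec H).card := by
      exact_mod_cast this
    linarith
  have h3 : ((I3.biUnion (life rec H)).card : ℝ) ≤ ∑ i ∈ I3, (l i : ℝ) := by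
    exact_mod_cast Finset.card_biUnion_le
  have h4 : (N : ℝ) ≤ (I1.biUnion (life rec H)).card + (I2.biUnion (life rec H)).card +
      (I3.biUnion (life rec H)).card := by exact_mod_cast hcover
  linarith

/-! ### Numerical estimates -/

theorem add_add_one_le {n d : ℕ} (hn : 1 ≤ n) (hd : 1 ≤ d) :
    (n : ℝ) + d + 1 ≤ 3 * ((n : ℝ) * Real.log n + d) := by
  have hd' : (1 : ℝ) ≤ d := by exact_mod_cast hd
  rcases hn.eq_or_lt with rfl | hn2
  · simp
    linarith
  · have hn2' : (2 : ℝ) ≤ n := by exact_mod_cast hn2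
    have h1 : Real.log 2 ≤ Real.log n := Real.log_le_log two_pos hn2'
    have := Real.log_two_gt_d9
    nlinarith

theorem exists_log_le_mul_sqrt {ε : ℝ} (hε : 0 < ε) :
    ∃ x₀ : ℝ, ∀ x ≥ x₀, Real.log (x + 3) ≤ ε * Real.sqrt x := by
  have h := (isLittleO_log_rpow_atTop (r := 1 / 2) (by norm_num)).bound
    (show 0 < ε / 2 by positivity)
  have h2 := (Filter.tendsto_atTop_add_const_right Filter.atTop (3 : ℝ)
    Filter.tendsto_id).eventually h
  obtain ⟨x₀, hx₀⟩ := Filter.eventually_atTop.1 h2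
  refine ⟨max x₀ 1, fun x hx => ?_⟩
  have h1 : 1 ≤ x := (le_max_right _ _).trans hx
  have h3 := hx₀ x ((le_max_left _ _).trans hx)
  simp only [id] at h3
  rw [← Real.sqrt_eq_rpow, Real.norm_of_nonneg (Real.sqrt_nonneg _)] at h3
  have h4 : Real.sqrt (x + 3) ≤ 2 * Real.sqrt x := by
    rw [Real.sqrt_le_left (by positivity), mul_pow, Real.sq_sqrt (by linarith)]
    linarith
  have := (le_abs_self _).trans h3
  nlinarith

/-- A quantity that exceeds a large multiple of `n log n + d` cannot be of order
`n log N + d + √N log N`. -/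
theorem exists_const_lt {A : ℝ} (hA : 0 < A) :
    ∃ C : ℝ, 3 ≤ C ∧ ∀ n d N : ℕ, 1 ≤ n → 1 ≤ d →
      C * ((n : ℝ) * Real.log n + d) < N →
      A * (n * Real.log ((N : ℝ) + 3) + d + Real.sqrt N * Real.log ((N : ℝ) + 3)) < N := by
  obtain ⟨x₀, hx₀⟩ := exists_log_le_mul_sqrt (show 0 < 1 / (4 * A) by positivity)
  refine ⟨max 3 (max (12 * A) x₀), le_max_left _ _, fun n d N hn hd hN => ?_⟩
  set C := max 3 (max (12 * A) x₀) with hC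
  have hC3 : 3 ≤ C := le_max_left _ _
  have hCA : 12 * A ≤ C := (le_max_left _ _).trans (le_max_right _ _)
  have hCx : x₀ ≤ C := (le_max_right _ _).trans (le_max_right _ _)
  have hn' : (1 : ℝ) ≤ n := by exact_mod_cast hn
  have hd' : (1 : ℝ) ≤ d := by exact_mod_cast hd
  have hnl : 0 ≤ (n : ℝ) * Real.log n := mul_nonneg (by linarith) (Real.log_nonneg hn')
  have hN0 : (0 : ℝ) < N := lt_of_le_of_lt (by positivity) hN
  have hNd : C * d ≤ N := by nlinarith
  have hNC : C ≤ N := by nlinarith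
  have hNl : C * ((n : ℝ) * Real.log n) ≤ N := by nlinarith
  have hlog := hx₀ N (hCx.trans hNC)
  have hsq : Real.sqrt N * Real.sqrt N = N := Real.mul_self_sqrt hN0.le
  have hsq0 : 0 ≤ Real.sqrt N := Real.sqrt_nonneg _
  have h3 : A * (Real.sqrt N * Real.log ((N : ℝ) + 3)) ≤ N / 4 := by
    have h := mul_le_mul_of_nonneg_left hlog (mul_nonneg hA.le hsq0)
    have e : A * Real.sqrt N * (1 / (4 * A) * Real.sqrt N) = N / 4 := by
      field_simp
      exact Real.sq_sqrt hN0.le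
    linarith
  have h2 : A * d ≤ N / 12 := by
    have := mul_le_mul_of_nonneg_right hCA (zero_le_one.trans hd')
    linarith
  have h1 : A * (n * Real.log ((N : ℝ) + 3)) ≤ N / 4 := by
    -- Either the term is dominated by `√N log N`, or `N ≤ n²` and `log N` may be replaced by a
    -- multiple of `log n`.
    by_cases hc : (n : ℝ) ≤ Real.sqrt N
    · refine le_trans ?_ h3
      have := one_le_log_age N
      gcongr
    · push Not at hc
      have hNn : (N : ℝ) ≤ (n : ℝ) ^ 2 := by nlinarith
      have hn2 : (2 : ℝ) ≤ n := by
        have : 1 < n := by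
          by_contra h1
          have : n = 1 := by omega
          subst this
          rw [Nat.cast_one, one_pow] at hNn
          linarith
        exact_mod_cast this
      have h4 : Real.log ((N : ℝ) + 3) ≤ 3 * Real.log n := by
        have h5 : (n : ℝ) ^ 2 * 2 ≤ n ^ 2 * n := by gcongr
        have h6 : (N : ℝ) + 3 ≤ (n : ℝ) ^ 3 := by nlinarith
        have : Real.log ((N : ℝ) + 3) ≤ Real.log ((n : ℝ) ^ 3) :=
          Real.log_le_log (by positivity) h6
        rw [Real.log_pow] at this
        exact_mod_cast this
      have h5 : A * (n * Real.log ((N : ℝ) + 3)) ≤ A * (n * (3 * Real.log n)) := by gcongr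
      have := mul_le_mul_of_nonneg_right hCA hnl
      linarith
  linarith

theorem log_add_three_le_mul_sqrt {N : ℕ} (hN : 1 ≤ N) :
    Real.log ((N : ℝ) + 3) ≤ 4 * Real.sqrt N := by
  have hN' : (1 : ℝ) ≤ N := by exact_mod_cast hN
  have h1 := Real.log_le_sub_one_of_pos (x := Real.sqrt ((N : ℝ) + 3)) (by positivity)
  rw [Real.log_sqrt (by positivity)] at h1
  have h2 : Real.sqrt ((N : ℝ) + 3) ≤ 2 * Real.sqrt N := by
    rw [Real.sqrt_le_left (by positivity), mul_pow, Real.sq_sqrt (by linarith)]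
    linarith
  linarith

theorem exists_nat_log_ge (c : ℝ) :
    ∃ K : ℕ, 4 ≤ K ∧ c ≤ Real.exp (-4) / 8 * Real.log ((K : ℝ) / 2) := by
  obtain ⟨m, hm⟩ := exists_nat_ge (2 * Real.exp (8 * c * Real.exp 4))
  refine ⟨m + 4, by omega, ?_⟩
  have h1 : 8 * c * Real.exp 4 ≤ Real.log (((m + 4 : ℕ) : ℝ) / 2) := by
    rw [Real.le_log_iff_exp_le (by positivity)]
    push_cast
    linarith
  have h2 := mul_le_mul_of_nonneg_left h1 (show 0 ≤ Real.exp (-4) / 8 by positivity)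
  have e : Real.exp (-4) / 8 * (8 * c * Real.exp 4) = c := by
    rw [show Real.exp (-4) / 8 * (8 * c * Real.exp 4) = (Real.exp (-4) * Real.exp 4) * c by ring,
      ← Real.exp_add]
    norm_num
  rwa [e] at h2

/-! ### The bad events -/

/-- The histories with a prefix on which `W` reaches the level `M`. -/
def exceeds (W : History → ℝ) (M : ℝ) : Set History := {h | ∃ s, s <:+ h ∧ M ≤ W s}

theorem lt_of_not_mem_exceeds {W : History → ℝ} {M : ℝ} {h s : History}
    (hh : h ∉ exceeds W M) (hs : s <:+ h) : W s < M :=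
  not_le.1 fun hM => hh ⟨s, hs, hM⟩

/-- The potential that controls how long nodes survive in slots of low contention. -/
def nodePotential (n : ℕ) (z : ℝ) (h : History) : ℝ :=
  ∏ i ∈ Finset.range n, (1 + z * Real.exp (nodeDeficit backoff i h))

theorem sum_log_le_of_nodePotential_lt {n : ℕ} {z B : ℝ} (hz : 0 ≤ z) {h : History}
    (hh : nodePotential n z h < Real.exp (z * n + B)) :
    ∑ i ∈ Finset.range n, Real.log (1 + z * Real.exp (nodeDeficit backoff i h)) ≤ z * n + B := by
  have hpos : ∀ x : ℝ, 0 < 1 + z * Real.exp x := fun x => by positivity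
  rw [← Real.log_prod fun i _ => (hpos _).ne']
  have : 0 < nodePotential n z h := Finset.prod_pos fun i _ => hpos _
  exact ((Real.log_lt_iff_lt_exp this).2 hh).le

theorem nodePotential_nil_le {n : ℕ} {z : ℝ} (hz : 0 ≤ z) :
    nodePotential n z [] ≤ Real.exp (z * n) := by
  have h1 : nodePotential n z [] = (1 + z) ^ n := by
    simp [nodePotential, nodeDeficit, total]
  rw [h1, mul_comm, Real.exp_nat_mul]
  exact pow_le_pow_left₀ (by linarith) (by linarith [Real.add_one_le_exp z]) n

/-- The event that one of the potentials is exceptionally large. -/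
def atypical (n N : ℕ) (B : ℝ) : Set History :=
  (exceeds (fun h => Real.exp (successDeficit backoff (fun _ => True) h)) (Real.exp B) ∪
    ⋃ w ∈ Finset.range (n + 1),
      exceeds (fun h => Real.exp (successDeficit backoff (fun h => successes h = w) h))
        (Real.exp B)) ∪
  (exceeds (nodePotential n (1 / N)) (Real.exp (1 / N * n + B)) ∪
    exceeds (nodePotential n (1 / Real.sqrt N)) (Real.exp (1 / Real.sqrt N * n + B)))

/-- One global event, `n + 1` windows and two node potentials, each of probability at most `exp
(-B)`. -/
theorem measure_atypical_le (n N : ℕ) (B : ℝ) (E : Adversary) (T : ℕ) :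
    (execution backoff E T).toOuterMeasure (atypical n N B) ≤
      ENNReal.ofReal ((n + 4) * Real.exp (-B)) := by
  set μ := (execution backoff E T).toOuterMeasure with hμ
  have hS : ∀ φ, μ (exceeds (fun h => Real.exp (successDeficit backoff φ h)) (Real.exp B)) ≤
      ENNReal.ofReal (Real.exp (-B)) := by
    intro φ
    refine ((isSupermartingale_successDeficit backoff_le_half φ).maximal
      (Real.exp_pos B) E T).trans (ENNReal.ofReal_le_ofReal ?_)
    simp [successDeficit, total, Real.exp_neg]
  have hP : ∀ z : ℝ, 0 ≤ z → μ (exceeds (nodePotential n z) (Real.exp (z * n + B))) ≤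
      ENNReal.ofReal (Real.exp (-B)) := by
    intro z hz
    refine ((isSupermartingale_prod_nodeDeficit backoff_le_half n hz).maximal
      (Real.exp_pos (z * n + B)) E T).trans (ENNReal.ofReal_le_ofReal ?_)
    rw [div_le_iff₀ (Real.exp_pos _), ← Real.exp_add]
    refine (nodePotential_nil_le hz).trans_eq ?_
    congr 1
    ring
  have e : ENNReal.ofReal ((n + 4) * Real.exp (-B)) =
      (ENNReal.ofReal (Real.exp (-B)) + (n + 1 : ℕ) * ENNReal.ofReal (Real.exp (-B))) +
      (ENNReal.ofReal (Real.exp (-B)) + ENNReal.ofReal (Real.exp (-B))) := by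
    rw [← ENNReal.ofReal_natCast (n + 1), ← ENNReal.ofReal_mul (by positivity),
      ← ENNReal.ofReal_add (by positivity) (by positivity),
      ← ENNReal.ofReal_add (by positivity) (by positivity),
      ← ENNReal.ofReal_add (by positivity) (by positivity)]
    congr 1
    push_cast
    ring
  rw [e]
  refine (MeasureTheory.measure_union_le _ _).trans (add_le_add ?_ ?_)
  · refine (MeasureTheory.measure_union_le _ _).trans (add_le_add (hS _) ?_)
    refine (MeasureTheory.measure_biUnion_finset_le _ _).trans ?_
    refine (Finset.sum_le_card_nsmul _ _ _ fun w _ => hS _).trans_eq ?_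
    rw [Finset.card_range, nsmul_eq_mul]
  · exact (MeasureTheory.measure_union_le _ _).trans
      (add_le_add (hP _ (by positivity)) (hP _ (by positivity)))

theorem sum_success_window_le_one (rec : ℕ → SlotRecord) (H w : ℕ) :
    ∑ t ∈ (Finset.range H).filter (fun t => successes (hist rec t) = w),
      (if (rec t).success = true then (1 : ℝ) else 0) ≤ 1 := by
  rw [← Finset.sum_filter, Finset.sum_const, nsmul_eq_mul, mul_one]
  have key : ∀ a b, a < b → successes (hist rec a) = w → successes (hist rec b) = w →
      (rec a).success ≠ true := by
    intro a b hab ha hb hs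
    have h1 : successes (hist rec (a + 1)) = w + 1 := by
      rw [hist, successes, ha, if_pos hs]
    have h2 : successes (hist rec (a + 1)) ≤ successes (hist rec b) := by
      rw [successes_hist, successes_hist]
      exact Finset.card_le_card (Finset.filter_subset_filter _ (by simpa using hab))
    omega
  have : (((Finset.range H).filter (fun t => successes (hist rec t) = w)).filter
      fun t => (rec t).success = true).card ≤ 1 := by
    rw [Finset.card_le_one]
    intro a ha b hb
    simp only [Finset.mem_filter] at ha hb
    rcases lt_trichotomy a b with h | h | h
    · exact absurd ha.2 (key a b h ha.1.2 hb.1.2)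
    · exact h
    · exact absurd hb.2 (key b a h hb.1.2 ha.1.2)
  exact_mod_cast this

theorem typical_of_not_mem_atypical {rec : ℕ → SlotRecord} {H n d N : ℕ} {B : ℝ} {h : History}
    (hB : 0 ≤ B) (hsuf : hist rec H <:+ h) (hv : Valid h) (hi : injected h ≤ n)
    (hj : jams h ≤ d) (hh : h ∉ atypical n N B) : Typical rec H n d B := by
  simp only [atypical, Set.mem_union, Set.mem_iUnion, not_or, not_exists, Finset.mem_range] at hh
  obtain ⟨⟨h1, h2⟩, _⟩ := hh
  have hv' := hv.suffix hsuf
  have hi' := (injected_le_of_suffix hsuf).trans hi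
  have hsucc : successes (hist rec H) ≤ n := by
    have := successes_add_card_remaining hv'
    omega
  refine ⟨hv', hi', (jams_le_of_suffix hsuf).trans hj, hB, ?_, fun w hw => ?_⟩
  · have h3 := Real.exp_lt_exp.1 (lt_of_not_mem_exceeds h1 hsuf)
    rw [successDeficit, total_hist] at h3
    simp only [if_true] at h3
    rw [Finset.sum_sub_distrib, ← Finset.sum_div, ← Finset.sum_filter, Finset.sum_const,
      nsmul_eq_mul, mul_one, ← successes_hist] at h3
    have : (successes (hist rec H) : ℝ) ≤ n := by exact_mod_cast hsucc
    linarith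
  · have h3 := Real.exp_lt_exp.1 (lt_of_not_mem_exceeds (h2 w (by omega)) hsuf)
    rw [successDeficit, total_hist] at h3
    have h4 : ∑ t ∈ (Finset.range H).filter (fun t => successes (hist rec t) = w),
        (successRate backoff (hist rec t) (rec t) / 2 -
          if (rec t).success = true then (1 : ℝ) else 0) < B := by
      rw [Finset.sum_filter]
      convert h3
    rw [Finset.sum_sub_distrib, ← Finset.sum_div] at h4
    linarith [sum_success_window_le_one rec H w]

/-! ### The time cost -/

theorem exists_time_const {β : ℝ} (hβ : 0 ≤ β) :
    ∃ C : ℝ, 3 ≤ C ∧ ∀ n d : ℕ, 1 ≤ n → 1 ≤ d → ∀ E : Adversary, RespectsBudgets backoff E n d →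
      ∃ bad : Set History,
        (∀ T, (execution backoff E T).toOuterMeasure bad ≤
          ENNReal.ofReal (1 / ((n : ℝ) + (d : ℝ)) ^ β)) ∧
        ∀ T, ∀ h ∈ (execution backoff E T).support, h ∉ bad →
          (activeSlots h : ℝ) ≤ C * ((n : ℝ) * Real.log n + d) := by
  -- The extra power pays for the union bound over `n + 4` events.
  set b : ℝ := β + 1 with hb
  have hb1 : 1 ≤ b := by linarith
  -- With `c = 4b + 6` one has `c / 2 - 1 = 2b + 2`, which beats `B + 2` because `B = b * L ≤ 2b *
  -- log N`.
  obtain ⟨K, hK4, hK⟩ := exists_nat_log_ge (4 * b + 6)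
  have hKr : (4 : ℝ) ≤ K := by exact_mod_cast hK4
  obtain ⟨C, hC3, hC⟩ := exists_const_lt
    (A := 4 * K ^ 2 + 100000 * K * b) (by positivity)
  refine ⟨C, hC3, fun n d hn hd E hE => ?_⟩
  set x : ℝ := C * ((n : ℝ) * Real.log n + d) with hx
  set N : ℕ := ⌊x⌋₊ + 1 with hN
  have hn' : (1 : ℝ) ≤ n := by exact_mod_cast hn
  have hd' : (1 : ℝ) ≤ d := by exact_mod_cast hd
  have hnl : 0 ≤ (n : ℝ) * Real.log n := mul_nonneg (by linarith) (Real.log_nonneg hn')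
  have hxN : x < N := by
    rw [hN]
    push_cast
    exact Nat.lt_floor_add_one x
  have hndN : (n : ℝ) + d + 1 ≤ N := by
    have h1 := add_add_one_le hn hd
    have h2 : 3 * ((n : ℝ) * Real.log n + d) ≤ x := by
      rw [hx]
      gcongr
    linarith
  have hN3 : (3 : ℝ) ≤ N := by linarith
  set L : ℝ := Real.log ((N : ℝ) + 3) with hL
  have hL1 : 1 ≤ L := one_le_log_age N
  set B : ℝ := b * L with hB
  refine ⟨atypical n N B, fun T => ?_, fun T h hh hbad => ?_⟩
  · refine (measure_atypical_le n N B E T).trans (ENNReal.ofReal_le_ofReal ?_)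
    have hN3' : (0 : ℝ) < (N : ℝ) + 3 := by positivity
    have e : Real.exp (-B) = 1 / (((N : ℝ) + 3) ^ β * ((N : ℝ) + 3)) := by
      rw [← Real.rpow_add_one hN3'.ne', Real.exp_neg, one_div, Real.rpow_def_of_pos hN3']
      congr 2
      rw [hB, hb, hL]
      ring
    rw [e, mul_one_div]
    calc ((n : ℝ) + 4) / (((N : ℝ) + 3) ^ β * ((N : ℝ) + 3))
        ≤ ((N : ℝ) + 3) / (((N : ℝ) + 3) ^ β * ((N : ℝ) + 3)) := by
          exact div_le_div_of_nonneg_right (by linarith) (by positivity)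
      _ = 1 / ((N : ℝ) + 3) ^ β := by
          field_simp
      _ ≤ 1 / ((n : ℝ) + (d : ℝ)) ^ β := by
          refine one_div_le_one_div_of_le (by positivity) ?_
          exact Real.rpow_le_rpow (by positivity) (by linarith) hβ
  · by_contra hlt
    push Not at hlt
    have hNact : N ≤ activeSlots h := by
      have : ⌊x⌋₊ < activeSlots h := (Nat.floor_lt (by positivity)).2 hlt
      omega
    -- Cutting at exactly `N` active slots makes the logarithm `L` deterministic, matching the level
    -- `B` fixed in advance.
    obtain ⟨s, hs, hsN⟩ := exists_suffix_activeSlots_eq hNact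
    obtain ⟨rec, hrec⟩ := exists_hist_eq s
    set H := s.length
    rw [← hrec] at hs hsN
    have hT := typical_of_not_mem_atypical (N := N) (d := d) (by positivity) hs
      (valid_of_mem_support hh) (hE T h hh).1 (hE T h hh).2 hbad
    have hlS : logSlots rec H = L := by rw [logSlots, hsN]
    have hlogN : L ≤ 2 * Real.log N ∧ 1 ≤ Real.log N := by
      constructor
      · have : L ≤ Real.log ((N : ℝ) ^ 2) := Real.log_le_log (by positivity) (by nlinarith)
        rw [Real.log_pow] at this
        exact_mod_cast this
      · rw [Real.le_log_iff_exp_le (by positivity)]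
        linarith [Real.exp_one_lt_d9]
    have hmain := activeSlots_le hT hK4 (c := 4 * b + 6) (by linarith) hK hsN
      (by omega) (by
        have : (n : ℝ) ≤ N := by linarith
        exact_mod_cast this)
      (by
        have := mul_le_mul_of_nonneg_left hlogN.1 (zero_le_one.trans hb1)
        nlinarith [hlogN.2])
      (by
        simp only [atypical, Set.mem_union, not_or] at hbad
        rintro z (rfl | rfl)
        · exact sum_log_le_of_nodePotential_lt (by positivity)
            (lt_of_not_mem_exceeds hbad.2.1 hs)
        · exact sum_log_le_of_nodePotential_lt (by positivity)
            (lt_of_not_mem_exceeds hbad.2.2 hs))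
    have hbadcard := card_badSlots_le hT
    rw [hlS] at hbadcard
    have hLsq : L ≤ 4 * Real.sqrt N := log_add_three_le_mul_sqrt (by omega)
    have hfin := hC n d N hn hd hxN
    rw [← hL] at hfin
    set R := Real.sqrt N with hR
    have hR0 : 0 ≤ R := Real.sqrt_nonneg _
    set D : ℝ := ((badSlots rec H).card : ℝ) with hD
    have hnL : (n : ℝ) ≤ n * L := le_mul_of_one_le_right (by linarith) hL1
    have hRL0 : 0 ≤ R * L := by positivity
    have hnL0 : 0 ≤ (n : ℝ) * L := by positivity
    have hLL : L * L ≤ 4 * (R * L) := by nlinarith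
    have hnLb : (n : ℝ) * L ≤ b * (n * L) := le_mul_of_one_le_left hnL0 hb1
    have hdb : (d : ℝ) ≤ b * d := le_mul_of_one_le_left (by linarith) hb1
    have hDle : D ≤ b * (5000 * (n * L + d + R * L)) := by
      have h1 : b * (L * L) ≤ b * (4 * (R * L)) :=
        mul_le_mul_of_nonneg_left hLL (by linarith)
      have h2 : 0 ≤ b * (R * L) := by positivity
      have h3 : (0 : ℝ) ≤ b * d := by positivity
      have h4 : b * (n : ℝ) ≤ b * (n * L) := mul_le_mul_of_nonneg_left hnL (by linarith)
      have e1 : 2000 * (n : ℝ) * (B + 1) = 2000 * (b * (n * L)) + 2000 * n := by rw [hB]; ring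
      have e2 : 84 * L * ((n : ℝ) + B) = 84 * (n * L) + 84 * (b * (L * L)) := by rw [hB]; ring
      linarith
    have hDK : 18 * K * D ≤ K * (b * (90000 * (n * L + d + R * L))) := by
      have := mul_le_mul_of_nonneg_left hDle (show (0 : ℝ) ≤ 18 * K by positivity)
      linarith
    have hKb : (1 : ℝ) ≤ K * b := by nlinarith
    have hS0 : 0 ≤ (n : ℝ) * L + d + R * L := by positivity
    have hnS : (n : ℝ) ≤ n * L + d + R * L := by linarith
    have h5 : 4 * (K : ℝ) ^ 2 * n ≤ 4 * K ^ 2 * (n * L + d + R * L) := by gcongr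
    have h6 : 2 * (n : ℝ) ≤ 2 * (K * b * (n * L + d + R * L)) := by
      have := le_mul_of_one_le_left hS0 hKb
      linarith
    have h7 : 2 * R * B ≤ 2 * (K * b * (n * L + d + R * L)) := by
      have h8 : R * B ≤ K * (b * (R * L)) := by
        rw [show R * B = b * (R * L) by rw [hB]; ring]
        exact le_mul_of_one_le_left (by positivity) (by linarith)
      have h9 : K * (b * (R * L)) ≤ K * (b * (n * L + d + R * L)) := by
        gcongr
        linarith
      linarith
    have h10 : 0 ≤ K * b * (n * L + d + R * L) := by positivity
    linarith

theorem achievesTimeCost_backoff :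
    AchievesTimeCost backoff (fun n => (n : ℝ) * Real.log n) (fun d => (d : ℝ)) := by
  intro β hβ
  obtain ⟨C, _, hC⟩ := exists_time_const (β := β) (by linarith)
  refine ⟨C, fun n d hn hd E hE => ?_⟩
  obtain ⟨bad, h1, h2⟩ := hC n d hn hd E hE
  exact holdsWithProb_of_bad (by positivity) h1 h2

/-! ### The energy cost -/

theorem IsSupermartingale.sum {A : Algorithm} {W : ℕ → History → ℝ} (s : Finset ℕ)
    (hW : ∀ i, IsSupermartingale A (W i)) :
    IsSupermartingale A fun h => ∑ i ∈ s, W i h := by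
  refine ⟨fun h => Finset.sum_nonneg fun i _ => (hW i).1 h, fun h k J => ?_⟩
  simp only [Finset.mul_sum]
  rw [Finset.sum_comm]
  exact Finset.sum_le_sum fun i _ => (hW i).2 h k J

/-- The bound is pathwise: ages within a lifetime are distinct and the high rate decreases, so the
lifetime alone matters. -/
theorem expectedAttempts_le (h : History) (i : ℕ) :
    expectedAttempts backoff i h ≤ Real.log ((activeSlots h : ℝ) + 3) ^ 2 := by
  obtain ⟨rec, hrec⟩ := exists_hist_eq h
  rw [← hrec]
  set H := h.length
  rw [expectedAttempts, total_hist]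
  have e : ∀ t, (if i ∈ activeNodes (hist rec t) (rec t).arrivals then
      (backoff (localView i (hist rec t)) : ℝ) else 0) =
      if i ∈ act rec t then (backoff (localView i (hist rec t)) : ℝ) else 0 := fun t => rfl
  simp only [e]
  rw [← Finset.sum_filter]
  calc _ ≤ ∑ t ∈ life rec H i, highRate (age i (hist rec t)) :=
        Finset.sum_le_sum fun t _ => backoffProb_le_highRate _
    _ ≤ ∑ a ∈ Finset.range (life rec H i).card, highRate a :=
        sum_life_le antitone_highRate subset_rfl
    _ ≤ Real.log (((life rec H i).card : ℝ) + 3) ^ 2 := sum_highRate_le _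
    _ ≤ _ := by
        have h1 : ((life rec H i).card : ℝ) ≤ activeSlots (hist rec H) := by
          exact_mod_cast card_life_le rec H i
        have h2 := one_le_log_age (life rec H i).card
        have h3 : Real.log (((life rec H i).card : ℝ) + 3) ≤
            Real.log ((activeSlots (hist rec H) : ℝ) + 3) :=
          Real.log_le_log (by positivity) (by linarith)
        gcongr

theorem two_thirds_le_log_add_one {m : ℝ} (hm : 1 ≤ m) : 2 / 3 ≤ Real.log (m + 1) := by
  have h3 : Real.log 2 ≤ Real.log (m + 1) := Real.log_le_log two_pos (by linarith)
  have := Real.log_two_gt_d9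
  linarith

theorem log_add_three_le {C n d N : ℝ} (hC : 0 ≤ C) (hn : 1 ≤ n) (hd : 1 ≤ d) (hN0 : 0 ≤ N)
    (hN : N ≤ C * (n * Real.log n + d)) :
    Real.log (N + 3) ≤ Real.log (C + 3) + 2 * Real.log (n + 1) + Real.log (d + 1) := by
  have e : Real.log (C + 3) + 2 * Real.log (n + 1) + Real.log (d + 1) =
      Real.log ((C + 3) * (n + 1) ^ 2 * (d + 1)) := by
    rw [Real.log_mul (by positivity) (by positivity),
      Real.log_mul (by positivity) (by positivity), Real.log_pow]
    push_cast
    ring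
  rw [e]
  refine Real.log_le_log (by positivity) ?_
  have h9 : Real.log n ≤ n := by
    have := Real.log_le_sub_one_of_pos (x := n) (by positivity)
    linarith
  have h11 : n * Real.log n ≤ n * n := by gcongr
  have h10 : n * Real.log n + d + 1 ≤ (n + 1) ^ 2 * (d + 1) := by
    have h12 : 0 ≤ n ^ 2 * d := by positivity
    have h13 : 0 ≤ n * d := by positivity
    linarith
  have h12 : N + 3 ≤ (C + 3) * (n * Real.log n + d + 1) := by
    have : 0 ≤ n * Real.log n := mul_nonneg (by linarith) (Real.log_nonneg hn)
    linarith
  calc _ ≤ _ := h12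
    _ ≤ (C + 3) * ((n + 1) ^ 2 * (d + 1)) := by gcongr
    _ = _ := by ring

theorem two_mul_sq_add_le {β a x y : ℝ} (hβ : 0 ≤ β) (hx : 2 / 3 ≤ x) (hy : 2 / 3 ≤ y) :
    2 * (a + 2 * x + y) ^ 2 + (β + 2) * (x + y) ≤
      (18 * a ^ 2 + 24 + 2 * (β + 2)) * (x ^ 2 + y ^ 2) := by
  have h10 : (a + 2 * x + y) ^ 2 ≤ 3 * (a ^ 2 + 4 * x ^ 2 + y ^ 2) := by
    linarith [sq_nonneg (a - 2 * x), sq_nonneg (a - y), sq_nonneg (2 * x - y)]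
  have h11 : a ^ 2 ≤ a ^ 2 * (3 * (x ^ 2 + y ^ 2)) := by
    refine le_mul_of_one_le_right (sq_nonneg a) ?_
    nlinarith
  have h12 : (β + 2) * (x + y) ≤ (β + 2) * (2 * (x ^ 2 + y ^ 2)) := by
    refine mul_le_mul_of_nonneg_left ?_ (by linarith)
    nlinarith
  linarith [sq_nonneg y]

theorem achievesEnergyCost_backoff :
    AchievesEnergyCost backoff
      (fun n => Real.log ((n : ℝ) + 1) ^ 2) (fun d => Real.log ((d : ℝ) + 1) ^ 2) := by
  intro β hβ
  -- Two failure probabilities `(n + d)^(-(β + 1))` add up to at most `(n + d)^(-β)`, as `n + d ≥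
  -- 2`.
  obtain ⟨C, hC3, hC⟩ := exists_time_const (β := β + 1) (by linarith)
  set a := Real.log (C + 3) with ha
  refine ⟨18 * a ^ 2 + 24 + 2 * (β + 2), fun n d hn hd E hE => ?_⟩
  obtain ⟨bad, h1, h2⟩ := hC n d hn hd E hE
  have hn' : (1 : ℝ) ≤ n := by exact_mod_cast hn
  have hd' : (1 : ℝ) ≤ d := by exact_mod_cast hd
  have hnd : (0 : ℝ) < (n : ℝ) + d := by positivity
  -- The sum of the `n` node potentials starts at `n`, so this level gives failure probability `(n +
  -- d)^(-(β + 1))`.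
  set M : ℝ := n * ((n : ℝ) + d) ^ (β + 1) with hM
  have hM0 : 0 < M := by positivity
  set W : ℕ → History → ℝ := fun i h =>
    Real.exp (attempts i h - 2 * expectedAttempts backoff i h) with hW
  have hsup := IsSupermartingale.sum (Finset.range n) fun i => isSupermartingale_attempts backoff i
  refine holdsWithProb_of_bad
    (bad := bad ∪ exceeds (fun h => ∑ i ∈ Finset.range n, W i h) M) (by positivity)
    (fun T => ?_) (fun T h hh hbad => ?_)
  · refine (MeasureTheory.measure_union_le _ _).trans
      ((add_le_add (h1 T) (hsup.maximal hM0 E T)).trans ?_)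
    rw [← ENNReal.ofReal_add (by positivity) (div_nonneg (hsup.1 _) hM0.le)]
    refine ENNReal.ofReal_le_ofReal ?_
    have e : ∑ i ∈ Finset.range n, Real.exp (attempts i ([] : History) -
        2 * expectedAttempts backoff i []) = n := by
      simp [attempts, expectedAttempts, total]
    beta_reduce
    rw [e, hM, Real.rpow_add_one hnd.ne']
    have h3 : (0 : ℝ) < ((n : ℝ) + d) ^ β := by positivity
    have e2 : (1 : ℝ) / (((n : ℝ) + d) ^ β * (n + d)) +
        n / (n * (((n : ℝ) + d) ^ β * (n + d))) =
        1 / ((n : ℝ) + d) ^ β * (2 / (n + d)) := by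
      have : (n : ℝ) ≠ 0 := by positivity
      field_simp
      norm_num
    rw [e2]
    refine mul_le_of_le_one_right (by positivity) ?_
    rw [div_le_one hnd]
    linarith
  · rw [Set.mem_union, not_or] at hbad
    have hact := h2 T h hh hbad.1
    have hlt := lt_of_not_mem_exceeds hbad.2 List.suffix_rfl
    set x := Real.log ((n : ℝ) + 1) with hx
    set y := Real.log ((d : ℝ) + 1) with hy
    have hx0 : 2 / 3 ≤ x := two_thirds_le_log_add_one hn'
    have hy0 : 2 / 3 ≤ y := two_thirds_le_log_add_one hd'
    intro i
    change (attempts i h : ℝ) ≤ (18 * a ^ 2 + 24 + 2 * (β + 2)) * (x ^ 2 + y ^ 2)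
    by_cases hi : i < n
    swap
    · rw [attempts_eq_zero (valid_of_mem_support hh) ((hE T h hh).1.trans (not_lt.1 hi))]
      rw [Nat.cast_zero]
      positivity
    have hWi : W i h < M := lt_of_le_of_lt
      (Finset.single_le_sum (f := fun i => W i h) (fun j _ => (Real.exp_pos _).le)
        (Finset.mem_range.2 hi)) hlt
    have h4 : (attempts i h : ℝ) - 2 * expectedAttempts backoff i h < Real.log M :=
      (Real.lt_log_iff_exp_lt hM0).2 hWi
    have h5 := expectedAttempts_le h i
    have h6 : Real.log ((n : ℝ) + d) ≤ x + y := by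
      rw [hx, hy, ← Real.log_mul (by positivity) (by positivity)]
      exact Real.log_le_log hnd (by nlinarith)
    have h7 : Real.log M ≤ (β + 2) * (x + y) := by
      rw [hM, Real.log_mul (by positivity) (by positivity), Real.log_rpow hnd]
      have h8 : Real.log n ≤ Real.log ((n : ℝ) + d) := Real.log_le_log (by positivity) (by linarith)
      nlinarith
    have h8 : Real.log ((activeSlots h : ℝ) + 3) ≤ a + 2 * x + y :=
      log_add_three_le (by linarith) hn' hd' (Nat.cast_nonneg _) hact
    have h9 : Real.log ((activeSlots h : ℝ) + 3) ^ 2 ≤ (a + 2 * x + y) ^ 2 := by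
      have := one_le_log_age (activeSlots h)
      gcongr
    have h10 := two_mul_sq_add_le (β := β) (a := a) (by linarith) hx0 hy0
    linarith

end ContentionResolution

end

theorem theorem1p1 :
    ∃ A : ContentionResolution.Algorithm,
      ContentionResolution.AchievesTimeCost A
        (fun n => (n : ℝ) * Real.log n) (fun d => (d : ℝ)) ∧
      ContentionResolution.AchievesEnergyCost A
        (fun n => Real.log ((n : ℝ) + 1) ^ 2) (fun d => Real.log ((d : ℝ) + 1) ^ 2) :=
  ⟨ContentionResolution.backoff, ContentionResolution.achievesTimeCost_backoff,
    ContentionResolution.achievesEnergyCost_backoff⟩
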